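/- Let $\rho:\mathbb{R}\to\mathbb{R}$ be non-negative on $(0,\infty)$ and not almost everywhere zero there, and let $I\subseteq\mathbb{R}$ be an open set such that $\int_0^\infty x^i e^{tx}\rho(x)\,dx$ converges (absolutely) for all $t\in I$ and all integers $i\ge 0$. For $t\in I$ put $$\mu_{i,j}(t)=\iint_{(0,\infty)^2}x^iy^j\,\frac{x-y}{x+y}\,e^{t(x+y)}\rho(x)\rho(y)\,dx\,dy,\qquad \beta_i(t)=\int_0^\infty x^ie^{tx}\rho(x)\,dx .$$ Write $\mathrm{Pf}(a_1,\dots,a_{2N})$ for the Pfaffian of the skew-symmetric matrix $(\mathrm{Pf}(a_k,a_l))_{k,l}$ with entries $\mathrm{Pf}(i,j)=\mu_{i,j}$, $\mathrm{Pf}(d_0,i)=\beta_i$, $\mathrm{Pf}(i,z)=z^i$, $\mathrm{Pf}(d_0,z)=0$ (the Pfaffian of order $0$ is $1$), and put $$\tau_{2m}=\mathrm{Pf}(0,1,\dots,2m-1),\qquad \tau_{2m+1}=\mathrm{Pf}(d_0,0,1,\dots,2m),$$ $$P_{2m}(z;t)=\frac{\mathrm{Pf}(0,1,\dots,2m,z)}{\tau_{2m}},\qquad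 P_{2m+1}(z;t)=\frac{\mathrm{Pf}(d_0,0,1,\dots,2m+1,z)}{\tau_{2m+1}},$$ $$u_n=\frac{\tau_{n+1}\tau_{n-1}}{\tau_n^2},\qquad b_n=\frac{d}{dt}\log\tau_n=\frac{\tau_n'}{\tau_n},$$ with $\tau_{-1}=0$, $P_{-1}=P_{-2}=0$ and $u_{-1}=0$. For infinite sequences $u=(u_n)_{n\ge0}$, $b=(b_n)_{n\ge0}$ with $u_0=b_0=0$ define matrices with rows and columns indexed by $0,1,2,\dots$, all of whose entries not listed are $0$: * $L_1$: $(L_1)_{n,n}=1$, $(L_1)_{n,n-1}=u_n$; * $L_2$: $(L_2)_{n,n+1}=1$, $(L_2)_{n,n}=b_{n+1}-b_n+u_n$, $(L_2)_{n,n-1}=u_n(b_n-b_{n+1}-u_{n+1})$, $(L_2)_{n,n-2}=-u_n^2u_{n-1}$; * $B_2$: $(B_2)_{n,n-1}=u_n(b_{n+1}-b_{n-1})$; and $L=L_1^{-1}L_2$, $B=L_1^{-1}B_2$. **(a)** For every $t\in I$: all $\tau_n(t)$ are non-zero, all $\tau_n$ are differentiable at $t$, $u_0=b_0=0$, and the following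 hold. 1. (Four-term recurrence.) For all $n\ge 0$, $$z(P_n+u_nP_{n-1})=P_{n+1}+(b_{n+1}-b_n+u_n)P_n-u_n(b_{n+1}-b_n+u_{n+1})P_{n-1}-u_n^2u_{n-1}P_{n-2}.$$ 2. ($t$-evolution.) Each $P_n(z;t)$ is differentiable in $t$, and for all $n\ge1$, $$\partial_tP_n+u_n\,\partial_tP_{n-1}=u_n(b_{n+1}-b_{n-1})P_{n-1}.$$ 3. (Lax pair.) With $\Phi=(P_0,P_1,\dots)^{\top}$ one has $z\Phi=L\Phi$, $\Phi_t=B\Phi$ and $\dfrac{dL}{dt}=[B,L]=BL-LB$ (entrywise). 4. (1+1 B-Toda lattice.) For all $n\ge1$, $$\frac{du_n}{dt}=u_n(b_{n+1}-2b_n+b_{n-1}),\qquad \frac{db_n}{dt}=u_n(b_{n-1}-b_{n+1}).$$ **(b)** The compatibility condition gives the lattice: let $u_n,b_n$ ($n\ge0$) be arbitrary real functions of a real variable with $u_0=b_0=0$ identically, all differentiable at a point $t$, and form $L$ and $B$ from them. If the B-Toda equations in 4 hold at $t$, then $dL/dt=[B,L]$ holds at $t$. Conversely, if $dL/dt=[B,L]$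 holds at $t$, $u_n(t)\ne0$ for all $n\ge1$, and $b_{n+1}(t)\neq b_{n-1}(t)$ for at least one $n\ge1$, then the B-Toda equations in 4 hold at $t$. -/

import Mathlib

open MeasureTheory Set Polynomial

namespace BToda

/-- The Pfaffian of a skew-symmetric matrix of order `2N`, with the usual normalisation
`Pf A = 1 / (2^N N!) ∑_σ sgn σ ∏_{l<N} a_{σ(2l), σ(2l+1)}`; for skew-symmetric `A` each perfect
matching of the index set is counted `2^N N!` times with the same value, so that this is the
signed sum over all perfect matchings. The Pfaffian of order `0` is `1`. -/
noncomputable def pf {R : Type*} [CommRing R] [Algebra ℚ R] {N : ℕ}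
    (A : Matrix (Fin (2 * N)) (Fin (2 * N)) R) : R :=
  ((2 ^ N * (Nat.factorial N : ℚ))⁻¹) •
    ∑ σ : Equiv.Perm (Fin (2 * N)), ((Equiv.Perm.sign σ : ℤ) : R) *
      ∏ l : Fin N, A (σ ⟨2 * l.val, by omega⟩) (σ ⟨2 * l.val + 1, by omega⟩)

/-- The Pfaffian `Pf(s_0, …, s_{2N-1})` of a word of labels, with Pfaffian entries `e`. -/
noncomputable def pfWord {α R : Type*} [CommRing R] [Algebra ℚ R] {N : ℕ}
    (e : α → α → R) (s : Fin (2 * N) → α) : R :=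
  pf (Matrix.of fun i j => e (s i) (s j))

/-- `μ_{i,j}(t) = ∬_{x,y>0} x^i y^j (x-y)/(x+y) exp(t(x+y)) ρ(x) ρ(y) dx dy`. -/
noncomputable def mu (ρ : ℝ → ℝ) (t : ℝ) (i j : ℕ) : ℝ :=
  ∫ p in Ioi (0 : ℝ) ×ˢ Ioi (0 : ℝ),
    p.1 ^ i * p.2 ^ j * ((p.1 - p.2) / (p.1 + p.2)) * Real.exp (t * (p.1 + p.2)) *
      (ρ p.1 * ρ p.2)

/-- `β_i(t) = ∫_{x>0} x^i exp(tx) ρ(x) dx`. -/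
noncomputable def beta (ρ : ℝ → ℝ) (t : ℝ) (i : ℕ) : ℝ :=
  ∫ x in Ioi (0 : ℝ), x ^ i * Real.exp (t * x) * ρ x

/-- The labels `d_0` and `0, 1, 2, …` of Pfaffian entries. -/
inductive Label where
  | d0 : Label
  | idx : ℕ → Label

/-- The skew-symmetric Pfaffian entries `Pf(i,j) = μ_{i,j}`, `Pf(d_0,i) = β_i`. -/
noncomputable def entry (ρ : ℝ → ℝ) (t : ℝ) : Label → Label → ℝ
  | .idx i, .idx j => mu ρ t i j
  | .d0, .idx i => beta ρ t i
  | .idx i, .d0 => -beta ρ t i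
  | .d0, .d0 => 0

/-- The Pfaffian entries with the additional label `z`, which is `none` here:
`Pf(i,z) = z^i`, `Pf(d_0,z) = 0`; the other labels are `some a`. -/
noncomputable def entryZ (ρ : ℝ → ℝ) (t : ℝ) : Option Label → Option Label → ℝ[X]
  | some a, some b => C (entry ρ t a b)
  | some (.idx i), none => X ^ i
  | none, some (.idx i) => -X ^ i
  | some .d0, none => 0
  | none, some .d0 => 0
  | none, none => 0

/-- `τ_{2m} = Pf(0, 1, …, 2m-1)`. -/
noncomputable def tauEven (ρ : ℝ → ℝ) (m : ℕ) (t : ℝ) : ℝ :=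
  pfWord (N := m) (entry ρ t) fun k => Label.idx k

/-- `τ_{2m+1} = Pf(d_0, 0, 1, …, 2m)`. -/
noncomputable def tauOdd (ρ : ℝ → ℝ) (m : ℕ) (t : ℝ) : ℝ :=
  pfWord (N := m + 1) (entry ρ t)
    (Fin.cons (α := fun _ => Label) Label.d0 fun k : Fin (2 * m + 1) => Label.idx k)

/-- The tau function `τ_n(t)`. -/
noncomputable def tau (ρ : ℝ → ℝ) (n : ℕ) (t : ℝ) : ℝ :=
  if Even n then tauEven ρ (n / 2) t else tauOdd ρ (n / 2) t

/-- `Pf(0, 1, …, 2m, z)`. -/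
noncomputable def waveEven (ρ : ℝ → ℝ) (m : ℕ) (t : ℝ) : ℝ[X] :=
  pfWord (N := m + 1) (entryZ ρ t)
    (Fin.snoc (α := fun _ => Option Label)
      (fun k : Fin (2 * m + 1) => some (Label.idx k)) none)

/-- `Pf(d_0, 0, 1, …, 2m+1, z)`. -/
noncomputable def waveOdd (ρ : ℝ → ℝ) (m : ℕ) (t : ℝ) : ℝ[X] :=
  pfWord (N := m + 2) (entryZ ρ t)
    (Fin.cons (α := fun _ => Option Label) (some Label.d0)
      (Fin.snoc (α := fun _ => Option Label)
        (fun k : Fin (2 * m + 2) => some (Label.idx k)) none))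

/-- The partial-skew-orthogonal polynomials `P_{2m} = Pf(0, …, 2m, z) / τ_{2m}` and
`P_{2m+1} = Pf(d_0, 0, …, 2m+1, z) / τ_{2m+1}`, as polynomials in `z = X`. -/
noncomputable def psop (ρ : ℝ → ℝ) (n : ℕ) (t : ℝ) : ℝ[X] :=
  C (tau ρ n t)⁻¹ * if Even n then waveEven ρ (n / 2) t else waveOdd ρ (n / 2) t

/-- The sequence `n ↦ f_{n-1}`, where `f_{-1} = 0`. -/
def prev {α : Type*} [Zero α] (f : ℕ → α) : ℕ → α
  | 0 => 0
  | n + 1 => f n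

/-- `u_n = τ_{n+1} τ_{n-1} / τ_n^2`, where `τ_{-1} = 0` (hence `u_0 = 0`). -/
noncomputable def u (ρ : ℝ → ℝ) (n : ℕ) (t : ℝ) : ℝ :=
  tau ρ (n + 1) t * prev (fun k => tau ρ k t) n / tau ρ n t ^ 2

/-- `b_n = (d/dt) log τ_n`, that is, `τ_n' / τ_n` (the sign of `τ_n` is irrelevant). -/
noncomputable def b (ρ : ℝ → ℝ) (n : ℕ) (t : ℝ) : ℝ :=
  logDeriv (tau ρ n) t

/-! Matrices with rows and columns indexed by `0, 1, 2, …`. All those below are row-finite, so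
that the sums in the products are finite sums. -/

/-- The product of two infinite matrices, the first one row-finite. -/
noncomputable def mul (A B : Matrix ℕ ℕ ℝ) : Matrix ℕ ℕ ℝ :=
  Matrix.of fun n j => ∑ᶠ k, A n k * B k j

/-- A row-finite infinite matrix applied to an infinite column of polynomials. -/
noncomputable def mulVec (A : Matrix ℕ ℕ ℝ) (Φ : ℕ → ℝ[X]) : ℕ → ℝ[X] :=
  fun n => ∑ᶠ k, C (A n k) * Φ k

/-- Unit lower bidiagonal matrix with subdiagonal `u_1, u_2, …`. -/
def L1 (u : ℕ → ℝ) : Matrix ℕ ℕ ℝ :=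
  Matrix.of fun n j => if j = n then 1 else if j + 1 = n then u n else 0

/-- The inverse of `L1 u`, see `mul_L1_L1inv` and `mul_L1inv_L1`. -/
def L1inv (u : ℕ → ℝ) : Matrix ℕ ℕ ℝ :=
  Matrix.of fun n j => if j ≤ n then ∏ k ∈ Finset.Ioc j n, (-u k) else 0

theorem mul_L1_L1inv (u : ℕ → ℝ) : mul (L1 u) (L1inv u) = 1 := by
  ext n j
  simp only [mul, L1, L1inv, Matrix.of_apply, Matrix.one_apply]
  cases n with
  | zero =>
    rw [finsum_eq_single _ 0 (by intro x hx; simp [hx])]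
    by_cases h : j = 0
    · simp [h]
    · simp [h, Ne.symm h]
  | succ m =>
    rw [finsum_eq_sum_of_support_subset (s := {m, m + 1}) _ (by
      intro x hx
      by_contra h
      simp only [Finset.coe_insert, Finset.coe_singleton, mem_insert_iff, mem_singleton_iff,
        not_or] at h
      exact hx (by simp [h.1, h.2])), Finset.sum_pair (by omega)]
    rcases lt_trichotomy j (m + 1) with h | h | h
    · have h1 : j ≤ m := by omega
      have h2 : j ≤ m + 1 := by omega
      have h3 : m + 1 ≠ j := by omega
      simp [h1, h2, h3, Finset.prod_Ioc_succ_top h1]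
      ring
    · simp [h]
    · have h1 : ¬ j ≤ m := by omega
      have h2 : ¬ j ≤ m + 1 := by omega
      have h3 : m + 1 ≠ j := by omega
      simp [h1, h2, h3]

theorem mul_L1inv_L1 (u : ℕ → ℝ) : mul (L1inv u) (L1 u) = 1 := by
  ext n j
  simp only [mul, L1, L1inv, Matrix.of_apply, Matrix.one_apply]
  rw [finsum_eq_sum_of_support_subset (s := {j, j + 1}) _ (by
    intro x hx
    by_contra h
    simp only [Finset.coe_insert, Finset.coe_singleton, mem_insert_iff, mem_singleton_iff,
      not_or] at h
    exact hx (by simp [Ne.symm h.1, Ne.symm h.2])), Finset.sum_pair (by omega)]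
  rcases lt_trichotomy n j with h | h | h
  · have h1 : ¬ j ≤ n := by omega
    have h2 : ¬ j + 1 ≤ n := by omega
    have h3 : n ≠ j := by omega
    simp [h1, h2, h3]
  · simp [h]
  · have h1 : j ≤ n := by omega
    have h2 : j + 1 ≤ n := by omega
    have h3 : n ≠ j := by omega
    have h4 : Finset.Ioc j n = insert (j + 1) (Finset.Ioc (j + 1) n) := by
      ext k
      simp only [Finset.mem_Ioc, Finset.mem_insert]
      omega
    rw [h4, Finset.prod_insert (by simp)]
    simp [h1, h2, h3]
    ring

/-- The matrix `L_2`, with rows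
`… , -u_n^2 u_{n-1}, u_n (b_n - b_{n+1} - u_{n+1}), b_{n+1} - b_n + u_n, 1, …`. -/
def L2 (u b : ℕ → ℝ) : Matrix ℕ ℕ ℝ :=
  Matrix.of fun n j =>
    if j = n + 1 then 1
    else if j = n then b (n + 1) - b n + u n
    else if j + 1 = n then u n * (b n - b (n + 1) - u (n + 1))
    else if j + 2 = n then -(u n ^ 2 * u (j + 1))
    else 0

/-- The matrix `B_2`, whose only non-zero entries are `u_n (b_{n+1} - b_{n-1})`, `n ≥ 1`, on the
subdiagonal. -/
def B2 (u b : ℕ → ℝ) : Matrix ℕ ℕ ℝ :=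
  Matrix.of fun n j => if j + 1 = n then u n * (b (n + 1) - b j) else 0

/-- The Lax matrix `L = L_1⁻¹ L_2`. -/
noncomputable def laxL (u b : ℕ → ℝ) : Matrix ℕ ℕ ℝ := mul (L1inv u) (L2 u b)

/-- The matrix `B = L_1⁻¹ B_2`. -/
noncomputable def laxB (u b : ℕ → ℝ) : Matrix ℕ ℕ ℝ := mul (L1inv u) (B2 u b)

/-- The Lax equation `dL/dt = [B, L] = B L - L B`, entry by entry, at time `t`. -/
def LaxEqAt (u b : ℕ → ℝ → ℝ) (t : ℝ) : Prop :=
  ∀ i j : ℕ, HasDerivAt (fun s => laxL (fun n => u n s) (fun n => b n s) i j)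
    (mul (laxB (fun n => u n t) (fun n => b n t)) (laxL (fun n => u n t) (fun n => b n t)) i j -
      mul (laxL (fun n => u n t) (fun n => b n t)) (laxB (fun n => u n t) (fun n => b n t)) i j)
    t

/-- The 1+1 B-Toda lattice `u_n' = u_n (b_{n+1} - 2 b_n + b_{n-1})`,
`b_n' = u_n (b_{n-1} - b_{n+1})`, `n ≥ 1`, at time `t`. -/
def LatticeAt (u b : ℕ → ℝ → ℝ) (t : ℝ) : Prop :=
  ∀ n : ℕ,
    HasDerivAt (u (n + 1)) (u (n + 1) t * (b (n + 2) t - 2 * b (n + 1) t + b n t)) t ∧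
    HasDerivAt (b (n + 1)) (u (n + 1) t * (b n t - b (n + 2) t)) t

end BToda

/-! Write ⟨p, q⟩ for the skew form with Gram matrix μ and set B(p, q) = ⟨p, q⟩ + β(p) β(q). Since
(x-y)/(x+y) + 1 = 2x/(x+y), B has a Cauchy-type kernel and is nondegenerate on polynomials of degree
at most n (`form_nondegenerate`). Indeed F(y) = ∫ x/(x+y) q(x) w(x) dx has at most deg q positive
zeros, so some g of degree at most deg q has the sign of F, and B(q, g) = 0 would force ∫ g F w = 0.

Pfaffians enter only through linearity in one label and vanishing on a repeated label. They show
that P_n has leading coefficient 1, that B(P_n, q) = (-1)^n h_n β(q) for deg q ≤ n with h_n =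
τ_{n+1}/τ_n, and that β(P_n) is h_n for even n and 0 for odd n. Nondegeneracy gives τ_n ≠ 0 by
induction (`tau_ne_zero`).

Multiplication by x + y cancels the denominator of the kernel, so B(Xp, q) + B(p, Xq) and, for fixed
p and q, dB(p, q)/dt both equal the rank-one form 2 β(Xp) β(q). With u = h_{n+1}/h_n, the
combination P_{n+1} + u P_n is B-orthogonal to all degrees at most n. After differentiating in t, or
multiplying by X and removing leading terms, one gets a polynomial of degree at most n whose pairing
with every q of degree at most n is a constant times β(q). Such a polynomial is a multiple of P_n.
This yields the evolution (`OrthData.deriv_combination`) and the four-term recurrence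
(`OrthData.recurrence_add_two`), the coefficients being found by applying β and pairing with one
more P_k.

The recurrence identifies b_{n+1} with minus the subleading coefficient of P_{n+1}, so the evolution
gives the equation for b_n; the equation for u_n is the logarithmic derivative of its definition.

For the Lax pair, L = H - B with H tridiagonal and B now the Lax matrix (`laxL_eq`), so [B, L] = [B,
H] has closed-form entries. They match dL/dt under the lattice. Conversely, the diagonal gives b_n',
and the entries below it give linear relations for the defects g_k = u_k'/u_k - (b_{k+1} - 2 b_k +
b_{k-1}); one nonzero b_{m+2} - b_m makes all of them vanish. -/

namespace BToda

/-! ### Pfaffians as normalised sums over permutations -/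

section Pfaffian

/-- The signed product attached to the permutation `σ` in the definition of the Pfaffian. -/
noncomputable def pfTerm {R : Type*} [CommRing R] {N : ℕ}
    (A : Matrix (Fin (2 * N)) (Fin (2 * N)) R) (σ : Equiv.Perm (Fin (2 * N))) : R :=
  ((Equiv.Perm.sign σ : ℤ) : R) *
    ∏ l : Fin N, A (σ ⟨2 * l.val, by omega⟩) (σ ⟨2 * l.val + 1, by omega⟩)

theorem pf_eq_sum_pfTerm {R : Type*} [CommRing R] [Algebra ℚ R] {N : ℕ}
    (A : Matrix (Fin (2 * N)) (Fin (2 * N)) R) :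
    pf A = ((2 ^ N * (Nat.factorial N : ℚ))⁻¹) • ∑ σ, pfTerm A σ := rfl

theorem map_pf {R S : Type*} [CommRing R] [Algebra ℚ R] [CommRing S] [Algebra ℚ S] {N : ℕ}
    (f : R →+* S) (A : Matrix (Fin (2 * N)) (Fin (2 * N)) R) : f (pf A) = pf (A.map f) := by
  simp only [pf, map_rat_smul, map_sum, map_mul, map_intCast, map_prod, Matrix.map_apply]

theorem pf_submatrix {R : Type*} [CommRing R] [Algebra ℚ R] {N : ℕ}
    (A : Matrix (Fin (2 * N)) (Fin (2 * N)) R) (π : Equiv.Perm (Fin (2 * N))) :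
    pf (A.submatrix π π) = ((Equiv.Perm.sign π : ℤ) : R) * pf A := by
  have h : ∑ σ, pfTerm (A.submatrix π π) σ =
      ((Equiv.Perm.sign π : ℤ) : R) * ∑ σ, pfTerm A σ := by
    rw [Finset.mul_sum]
    refine Fintype.sum_equiv (Equiv.mulLeft π) _ _ fun σ => ?_
    have h1 : ((Equiv.Perm.sign π : ℤ) : R) * ((Equiv.Perm.sign π : ℤ) : R) = 1 := by
      rw [← Int.cast_mul, Int.units_coe_mul_self, Int.cast_one]
    simp only [pfTerm, Equiv.coe_mulLeft, Equiv.Perm.sign_mul, Units.val_mul, Int.cast_mul,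
      Equiv.Perm.mul_apply, Matrix.submatrix_apply]
    rw [← mul_assoc, ← mul_assoc, h1, one_mul]
  rw [pf_eq_sum_pfTerm, pf_eq_sum_pfTerm, h, mul_smul_comm]

/-- A cycle of even length is an odd permutation. -/
theorem pf_submatrix_finRotate {N : ℕ} (A : Matrix (Fin (2 * (N + 1))) (Fin (2 * (N + 1))) ℝ) :
    pf (A.submatrix (finRotate _) (finRotate _)) = -pf A := by
  rw [pf_submatrix, sign_finRotate, show 2 * (N + 1) - 1 = 2 * N + 1 by omega]
  simp [pow_succ, pow_mul]

/-- Exchanging the two equal indices fixes the matrix but changes the sign of the Pfaffian. -/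
theorem pf_eq_zero_of_eq {N : ℕ} (A : Matrix (Fin (2 * N)) (Fin (2 * N)) ℝ) {i j : Fin (2 * N)}
    (hij : i ≠ j) (hrow : ∀ k, A i k = A j k) (hcol : ∀ k, A k i = A k j) : pf A = 0 := by
  have h1 : ∀ a b, A (Equiv.swap i j a) b = A a b := by
    intro a b
    rw [Equiv.swap_apply_def]
    split_ifs with h h'
    · rw [h, hrow]
    · rw [h', hrow]
    · rfl
  have h2 : ∀ a b, A a (Equiv.swap i j b) = A a b := by
    intro a b
    rw [Equiv.swap_apply_def]
    split_ifs with h h'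
    · rw [h, hcol]
    · rw [h', hcol]
    · rfl
  have h3 : A.submatrix (Equiv.swap i j) (Equiv.swap i j) = A := by
    ext a b
    rw [Matrix.submatrix_apply, h1, h2]
  have h4 := pf_submatrix A (Equiv.swap i j)
  rw [h3, Equiv.Perm.sign_swap hij] at h4
  norm_num at h4
  linarith

/-- The Pfaffian is linear in the `k`-th row and column. -/
theorem pf_linear {N : ℕ} {A A₁ A₂ : Matrix (Fin (2 * N)) (Fin (2 * N)) ℝ} (k : Fin (2 * N))
    (c₁ c₂ : ℝ) (h₁ : ∀ i j, i ≠ k → j ≠ k → A i j = A₁ i j)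
    (h₂ : ∀ i j, i ≠ k → j ≠ k → A i j = A₂ i j)
    (hcol : ∀ i, i ≠ k → A i k = c₁ * A₁ i k + c₂ * A₂ i k)
    (hrow : ∀ i, i ≠ k → A k i = c₁ * A₁ k i + c₂ * A₂ k i) :
    pf A = c₁ * pf A₁ + c₂ * pf A₂ := by
  have h : ∀ σ, pfTerm A σ = c₁ * pfTerm A₁ σ + c₂ * pfTerm A₂ σ := by
    intro σ
    -- The index `k` occurs in exactly one factor, the one for the pair `p / 2`; all other factors
    -- agree for the three matrices. The parity of `p` tells whether `k` is the row or the column of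
    -- that factor.
    set p := σ.symm k with hp
    have hσ : ∀ q, σ q = k ↔ q = p := by
      intro q
      rw [hp, Equiv.eq_symm_apply]
    have hpl : p.val / 2 < N := by omega
    set l₀ : Fin N := ⟨p.val / 2, hpl⟩ with hl₀
    have hne : ∀ l ∈ Finset.univ.erase l₀, σ ⟨2 * l.val, by omega⟩ ≠ k ∧
        σ ⟨2 * l.val + 1, by omega⟩ ≠ k := by
      intro l hl
      have hl' : l.val ≠ p.val / 2 := by
        intro h
        exact (Finset.ne_of_mem_erase hl) (Fin.ext h)
      rw [Ne, Ne, hσ, hσ, Fin.ext_iff, Fin.ext_iff]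
      simp only
      omega
    simp only [pfTerm, ← Finset.mul_prod_erase _ _ (Finset.mem_univ l₀)]
    rw [← Finset.prod_congr rfl fun l hl => h₁ _ _ (hne l hl).1 (hne l hl).2,
      ← Finset.prod_congr rfl fun l hl => h₂ _ _ (hne l hl).1 (hne l hl).2]
    have key : A (σ ⟨2 * l₀.val, by omega⟩) (σ ⟨2 * l₀.val + 1, by omega⟩) =
        c₁ * A₁ (σ ⟨2 * l₀.val, by omega⟩) (σ ⟨2 * l₀.val + 1, by omega⟩) +
        c₂ * A₂ (σ ⟨2 * l₀.val, by omega⟩) (σ ⟨2 * l₀.val + 1, by omega⟩) := by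
      rcases Nat.mod_two_eq_zero_or_one p.val with h | h
      · have e1 : σ ⟨2 * l₀.val, by omega⟩ = k := by
          rw [hσ, Fin.ext_iff]; simp only [hl₀]; omega
        have e2 : σ ⟨2 * l₀.val + 1, by omega⟩ ≠ k := by
          rw [Ne, hσ, Fin.ext_iff]; simp only [hl₀]; omega
        rw [e1]; exact hrow _ e2
      · have e1 : σ ⟨2 * l₀.val + 1, by omega⟩ = k := by
          rw [hσ, Fin.ext_iff]; simp only [hl₀]; omega
        have e2 : σ ⟨2 * l₀.val, by omega⟩ ≠ k := by
          rw [Ne, hσ, Fin.ext_iff]; simp only [hl₀]; omega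
        rw [e1]; exact hcol _ e2
    rw [key]
    ring
  rw [pf_eq_sum_pfTerm, pf_eq_sum_pfTerm, pf_eq_sum_pfTerm, Finset.sum_congr rfl fun σ _ => h σ,
    Finset.sum_add_distrib, ← Finset.mul_sum, ← Finset.mul_sum, smul_add, mul_smul_comm,
    mul_smul_comm]

/-- Exchanging pair 0 with pair `l` is an even permutation that only permutes the factors of the
product. -/
theorem pfTerm_mul_blockSwap {N : ℕ} (A : Matrix (Fin (2 * (N + 1))) (Fin (2 * (N + 1))) ℝ)
    (σ : Equiv.Perm (Fin (2 * (N + 1)))) (l : Fin (N + 1)) :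
    pfTerm A (σ * (Equiv.swap ⟨0, by omega⟩ ⟨2 * l.val, by omega⟩ *
      Equiv.swap ⟨1, by omega⟩ ⟨2 * l.val + 1, by omega⟩)) = pfTerm A σ := by
  set π : Equiv.Perm (Fin (2 * (N + 1))) := Equiv.swap ⟨0, by omega⟩ ⟨2 * l.val, by omega⟩ *
      Equiv.swap ⟨1, by omega⟩ ⟨2 * l.val + 1, by omega⟩ with hπ
  have hs : Equiv.Perm.sign π = 1 := by
    rw [hπ, Equiv.Perm.sign_mul, Equiv.Perm.sign_swap', Equiv.Perm.sign_swap']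
    simp only [Fin.mk.injEq]
    by_cases h : l.val = 0 <;> simp [h]
  have h0 : ∀ m : Fin (N + 1), π ⟨2 * m.val, by omega⟩ =
      ⟨2 * (Equiv.swap 0 l m).val, by omega⟩ := by
    intro m
    have e : Equiv.swap (⟨1, by omega⟩ : Fin (2 * (N + 1))) ⟨2 * l.val + 1, by omega⟩
        ⟨2 * m.val, by omega⟩ = ⟨2 * m.val, by omega⟩ :=
      Equiv.swap_apply_of_ne_of_ne
        (by rw [Ne, Fin.ext_iff]; simp only; omega) (by rw [Ne, Fin.ext_iff]; simp only; omega)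
    rw [hπ, Equiv.Perm.mul_apply, e]
    simp only [Equiv.swap_apply_def, Fin.ext_iff]
    have : ((0 : Fin (N + 1)) : ℕ) = 0 := rfl
    split_ifs <;> simp_all
  have h1 : ∀ m : Fin (N + 1), π ⟨2 * m.val + 1, by omega⟩ =
      ⟨2 * (Equiv.swap 0 l m).val + 1, by omega⟩ := by
    intro m
    have e : Equiv.swap (⟨1, by omega⟩ : Fin (2 * (N + 1))) ⟨2 * l.val + 1, by omega⟩
        ⟨2 * m.val + 1, by omega⟩ = ⟨2 * (Equiv.swap 0 l m).val + 1, by omega⟩ := by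
      simp only [Equiv.swap_apply_def, Fin.ext_iff]
      have : ((0 : Fin (N + 1)) : ℕ) = 0 := rfl
      split_ifs <;> simp_all
    rw [hπ, Equiv.Perm.mul_apply, e, Equiv.swap_apply_of_ne_of_ne
      (by rw [Ne, Fin.ext_iff]; simp only; omega) (by rw [Ne, Fin.ext_iff]; simp only; omega)]
  simp only [pfTerm, Equiv.Perm.sign_mul, hs, mul_one, Equiv.Perm.mul_apply, h0, h1]
  congr 1
  exact Equiv.prod_comp (Equiv.swap 0 l)
    (fun m : Fin (N + 1) => A (σ ⟨2 * m.val, by omega⟩) (σ ⟨2 * m.val + 1, by omega⟩))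

/-- Exchanging the two members of pair 0 changes the sign of the permutation and, by skew-symmetry,
that of one factor. -/
theorem pfTerm_mul_swap {N : ℕ} (A : Matrix (Fin (2 * (N + 1))) (Fin (2 * (N + 1))) ℝ)
    (hA : ∀ i j, A i j = -A j i) (σ : Equiv.Perm (Fin (2 * (N + 1)))) :
    pfTerm A (σ * Equiv.swap ⟨0, by omega⟩ ⟨1, by omega⟩) = pfTerm A σ := by
  have hs : Equiv.Perm.sign (Equiv.swap (⟨0, by omega⟩ : Fin (2 * (N + 1))) ⟨1, by omega⟩) = -1 :=
    Equiv.Perm.sign_swap (by simp)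
  have h : ∀ (m : Fin N) (r : ℕ) (hr : r < 2),
      Equiv.swap (⟨0, by omega⟩ : Fin (2 * (N + 1))) ⟨1, by omega⟩
        ⟨2 * m.succ.val + r, by omega⟩ = ⟨2 * m.succ.val + r, by omega⟩ := by
    intro m r hr
    refine Equiv.swap_apply_of_ne_of_ne ?_ ?_ <;>
    · rw [Ne, Fin.ext_iff]; simp only [Fin.val_succ]; omega
  simp only [pfTerm, Equiv.Perm.sign_mul, hs, Fin.prod_univ_succ, Equiv.Perm.mul_apply]
  rw [Finset.prod_congr rfl fun m _ => by
    rw [h m 1 (by omega), show (⟨2 * m.succ.val, by omega⟩ : Fin (2 * (N + 1))) =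
      ⟨2 * m.succ.val + 0, by omega⟩ from rfl, h m 0 (by omega)]]
  have e0 : Equiv.swap (⟨0, by omega⟩ : Fin (2 * (N + 1))) ⟨1, by omega⟩
      ⟨2 * ((0 : Fin (N + 1)) : ℕ), by omega⟩ = ⟨1, by omega⟩ := Equiv.swap_apply_left _ _
  have e1 : Equiv.swap (⟨0, by omega⟩ : Fin (2 * (N + 1))) ⟨1, by omega⟩
      ⟨2 * ((0 : Fin (N + 1)) : ℕ) + 1, by omega⟩ = ⟨0, by omega⟩ := Equiv.swap_apply_right _ _
  rw [e0, e1, hA]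
  simp

/-- Expansion of the Pfaffian along the first row, when its only non-zero entry is the second. -/
theorem pf_expand {N : ℕ} (A : Matrix (Fin (2 * N + 1 + 1)) (Fin (2 * N + 1 + 1)) ℝ)
    (hA : ∀ i j, A i j = -A j i) (h0 : ∀ j, j ≠ 1 → A 0 j = 0) :
    pf (N := N + 1) A = A 0 1 * pf (N := N)
      (A.submatrix (fun i : Fin (2 * N) => i.succ.succ) (fun i : Fin (2 * N) => i.succ.succ)) := by
  set F : Equiv.Perm (Fin (2 * N + 1 + 1)) → ℝ := pfTerm (N := N + 1) A with hF
  -- Any position can be moved to the front without changing the term: swap its pair with pair 0,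
  -- then, if it is odd, swap inside the pair. Hence all 2N+2 fibres of σ ↦ σ⁻¹(0) have the same
  -- sum.
  have hfix : ∀ p : Fin (2 * N + 1 + 1), ∃ π : Equiv.Perm (Fin (2 * N + 1 + 1)),
      π 0 = p ∧ ∀ σ, F (σ * π) = F σ := by
    intro p
    have hl : p.val / 2 < N + 1 := by omega
    have hb := fun σ => pfTerm_mul_blockSwap A σ ⟨p.val / 2, hl⟩
    have hsw := fun σ => pfTerm_mul_swap A hA σ
    have z : (0 : Fin (2 * N + 1 + 1)) = ⟨0, by omega⟩ := rfl
    have e0 : Equiv.swap (⟨1, by omega⟩ : Fin (2 * (N + 1)))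
        ⟨2 * (p.val / 2) + 1, by omega⟩ ⟨0, by omega⟩ = ⟨0, by omega⟩ :=
      Equiv.swap_apply_of_ne_of_ne (by simp) (by simp)
    have e1 : Equiv.swap (⟨0, by omega⟩ : Fin (2 * (N + 1)))
        ⟨2 * (p.val / 2), by omega⟩ ⟨2 * (p.val / 2) + 1, by omega⟩ =
        ⟨2 * (p.val / 2) + 1, by omega⟩ :=
      Equiv.swap_apply_of_ne_of_ne (by simp) (by simp)
    rcases Nat.mod_two_eq_zero_or_one p.val with h | h
    · refine ⟨_, ?_, hb⟩
      rw [z, Equiv.Perm.mul_apply]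
      refine (congrArg _ e0).trans ((Equiv.swap_apply_left _ _).trans (Fin.ext ?_))
      simp only
      omega
    · refine ⟨_, ?_, fun σ => (congrArg F (mul_assoc _ _ _)).symm.trans ((hsw _).trans (hb σ))⟩
      rw [z, Equiv.Perm.mul_apply, Equiv.Perm.mul_apply]
      refine (congrArg _ (congrArg _ (Equiv.swap_apply_left _ _))).trans
        ((congrArg _ (Equiv.swap_apply_left _ _)).trans (e1.trans (Fin.ext ?_)))
      simp only
      omega
  have hfib : ∀ p : Fin (2 * N + 1 + 1),
      ∑ σ with σ.symm 0 = p, F σ = ∑ σ with σ.symm 0 = 0, F σ := by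
    intro p
    obtain ⟨π, hπ, hFπ⟩ := hfix p
    refine Finset.sum_equiv (Equiv.mulRight π) ?_ ?_
    · intro σ
      simp only [Finset.mem_filter, Finset.mem_univ, true_and, Equiv.coe_mulRight,
        Equiv.symm_apply_eq, Equiv.Perm.mul_apply, hπ]
    · intro σ _
      exact (hFπ σ).symm
  have hzero : ∑ σ with σ.symm 0 = 0, F σ =
      ∑ e, F (Equiv.Perm.decomposeFin.symm (0, e)) := by
    symm
    refine Finset.sum_bij (fun e _ => Equiv.Perm.decomposeFin.symm (0, e)) ?_ ?_ ?_ ?_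
    · intro e _
      simp only [Finset.mem_filter, Finset.mem_univ, true_and, Equiv.symm_apply_eq,
        Equiv.Perm.decomposeFin_symm_apply_zero]
    · intro e _ e' _ h
      simpa using Equiv.Perm.decomposeFin.symm.injective h
    · intro σ hσ
      simp only [Finset.mem_filter, Finset.mem_univ, true_and, Equiv.symm_apply_eq] at hσ
      refine ⟨(Equiv.Perm.decomposeFin σ).2, Finset.mem_univ _, ?_⟩
      have h1 : (Equiv.Perm.decomposeFin σ).1 = 0 := by
        have := Equiv.Perm.decomposeFin_symm_apply_zero (Equiv.Perm.decomposeFin σ).1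
          (Equiv.Perm.decomposeFin σ).2
        rw [← this, Prod.mk.eta, Equiv.symm_apply_apply, ← hσ]
      rw [← h1, Prod.mk.eta, Equiv.symm_apply_apply]
    · intro e _
      rfl
  -- Once σ fixes 0, the value of σ at 1 is `q.succ`; the support of row 0 leaves only `q = 0`, and
  -- `e` permutes the remaining indices.
  have hterm : ∀ (q : Fin (2 * N + 1)) (e : Equiv.Perm (Fin (2 * N))),
      F (Equiv.Perm.decomposeFin.symm (0, Equiv.Perm.decomposeFin.symm (q, e))) =
      if q = 0 then A 0 1 * pfTerm (N := N) (A.submatrix (fun i : Fin (2 * N) => i.succ.succ)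
        (fun i : Fin (2 * N) => i.succ.succ)) e else 0 := by
    intro q e
    set σ := Equiv.Perm.decomposeFin.symm
      ((0 : Fin (2 * N + 1 + 1)), Equiv.Perm.decomposeFin.symm (q, e)) with hσ
    have hσ0 : σ 0 = 0 := Equiv.Perm.decomposeFin_symm_apply_zero _ _
    have hσ1 : σ 1 = q.succ := by
      rw [← Fin.succ_zero_eq_one, hσ, Equiv.Perm.decomposeFin_symm_apply_succ,
        Equiv.Perm.decomposeFin_symm_apply_zero]
      simp
    have h01 : F σ = ((Equiv.Perm.sign σ : ℤ) : ℝ) * (A 0 q.succ *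
        ∏ l : Fin N, A (σ (⟨2 * l.val, by omega⟩ : Fin (2 * N)).succ.succ)
          (σ (⟨2 * l.val + 1, by omega⟩ : Fin (2 * N)).succ.succ)) := by
      rw [hF, pfTerm, Fin.prod_univ_succ]
      have e0 : σ ⟨2 * ((0 : Fin (N + 1)) : ℕ), by omega⟩ = 0 := hσ0
      have e1 : σ ⟨2 * ((0 : Fin (N + 1)) : ℕ) + 1, by omega⟩ = q.succ := hσ1
      rw [e0, e1]
      rfl
    rw [h01]
    split_ifs with hq
    · subst hq
      have hs : ∀ x : Fin (2 * N), σ x.succ.succ = (e x).succ.succ := by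
        intro x
        rw [hσ, Equiv.Perm.decomposeFin_symm_apply_succ,
          Equiv.Perm.decomposeFin_symm_apply_succ]
        simp
      have hsg : Equiv.Perm.sign σ = Equiv.Perm.sign e := by
        rw [hσ, Equiv.Perm.decomposeFin.symm_sign, Equiv.Perm.decomposeFin.symm_sign]
        simp
      simp only [hs, hsg, pfTerm, Matrix.submatrix_apply, Fin.succ_zero_eq_one]
      ring
    · rw [h0 _ (by rw [← Fin.succ_zero_eq_one, Ne, Fin.succ_inj]; exact hq)]
      ring
  have hsum : ∑ σ, F σ = (2 * N + 2) * (A 0 1 * ∑ e, pfTerm (N := N)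
      (A.submatrix (fun i : Fin (2 * N) => i.succ.succ)
        (fun i : Fin (2 * N) => i.succ.succ)) e) := by
    rw [← Finset.sum_fiberwise Finset.univ (fun σ : Equiv.Perm _ => σ.symm 0) F,
      Finset.sum_congr rfl fun p _ => hfib p, Finset.sum_const, hzero,
      ← Equiv.sum_comp Equiv.Perm.decomposeFin.symm, Fintype.sum_prod_type,
      Finset.sum_congr rfl fun q _ => Finset.sum_congr rfl fun e _ => hterm q e]
    simp only [Finset.card_univ, Fintype.card_fin, nsmul_eq_mul, Finset.mul_sum]
    rw [Finset.sum_eq_single 0 (fun q _ hq => by simp [hq]) (by simp)]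
    simp only [if_true]
    push_cast
    congr 1
    ext e
    ring
  -- Normalisation: (2N+2) / (2^(N+1) (N+1)!) = 1 / (2^N N!).
  refine (congrArg (fun x : ℝ => ((2 ^ (N + 1) * (Nat.factorial (N + 1) : ℚ))⁻¹) • x) hsum).trans ?_
  rw [pf_eq_sum_pfTerm, Rat.smul_def, Rat.smul_def]
  push_cast [Nat.factorial_succ]
  have h1 : (N : ℝ) + 1 ≠ 0 := by positivity
  have h2 : (N.factorial : ℝ) ≠ 0 := by positivity
  field_simp
  ring

end Pfaffian

end BToda

namespace BToda

/-! ### Pfaffians bordered by one extra label -/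

section Wave

theorem finRotate_symm_zero (n : ℕ) : (finRotate (n + 1)).symm 0 = Fin.last n := by
  rw [Equiv.symm_apply_eq, finRotate_last]

theorem finRotate_symm_succ {n : ℕ} (i : Fin n) :
    (finRotate (n + 1)).symm i.succ = i.castSucc := by
  rw [Equiv.symm_apply_eq, finRotate_apply, Fin.coeSucc_eq_succ]

theorem pf_submatrix_finRotate_symm {N : ℕ}
    (A : Matrix (Fin (2 * N + 1 + 1)) (Fin (2 * N + 1 + 1)) ℝ) :
    pf (N := N + 1) (A.submatrix (finRotate (2 * N + 1 + 1)).symm (finRotate (2 * N + 1 + 1)).symm) =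
      -pf (N := N + 1) A := by
  have h := pf_submatrix_finRotate (N := N)
    (A.submatrix (finRotate (2 * N + 1 + 1)).symm (finRotate (2 * N + 1 + 1)).symm)
  have e : (Matrix.submatrix (A.submatrix (finRotate (2 * N + 1 + 1)).symm (finRotate (2 * N + 1 + 1)).symm)
      (finRotate (2 * (N + 1))) (finRotate (2 * (N + 1)))) = A := by
    ext i j
    exact congrArg₂ A (Equiv.symm_apply_apply (finRotate _) i)
      (Equiv.symm_apply_apply (finRotate _) j)
  rw [e] at h
  rw [h, neg_neg]

/-- Expansion of the Pfaffian along the last row, when its only non-zero entry is the last but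
one. -/
theorem pf_expand_last {N : ℕ} (A : Matrix (Fin (2 * N + 1 + 1)) (Fin (2 * N + 1 + 1)) ℝ)
    (hA : ∀ i j, A i j = -A j i)
    (h0 : ∀ j, j ≠ (Fin.last (2 * N)).castSucc → A (Fin.last (2 * N + 1)) j = 0) :
    pf (N := N + 1) A = A (Fin.last (2 * N)).castSucc (Fin.last (2 * N + 1)) * pf (N := N)
      (A.submatrix (fun i : Fin (2 * N) => i.castSucc.castSucc)
        (fun i : Fin (2 * N) => i.castSucc.castSucc)) := by
  -- Two rotations, whose signs cancel, bring the last two indices to the front; the swap puts the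
  -- last index first. The sign of the swap is absorbed by skew-symmetry at the end.
  set r := (finRotate (2 * N + 1 + 1)).symm with hr
  set A' := (A.submatrix r r).submatrix r r with hA'
  have h1 : pf (N := N + 1) A' = pf (N := N + 1) A := by
    rw [hA', pf_submatrix_finRotate_symm, pf_submatrix_finRotate_symm, neg_neg]
  set s : Equiv.Perm (Fin (2 * N + 1 + 1)) := Equiv.swap 0 1 with hs
  have h2 : pf (N := N + 1) (A'.submatrix s s) = -pf (N := N + 1) A' := by
    rw [pf_submatrix, hs, Equiv.Perm.sign_swap (by simp)]
    simp
  have r0 : r 0 = Fin.last _ := finRotate_symm_zero _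
  have rl : r (Fin.last _) = (Fin.last (2 * N)).castSucc := by
    rw [← Fin.succ_last, hr, finRotate_symm_succ]
  have r1 : r 1 = 0 := by
    rw [← Fin.succ_zero_eq_one, hr, finRotate_symm_succ, Fin.castSucc_zero]
  have t0 : r (r (s 0)) = Fin.last _ := by rw [hs, Equiv.swap_apply_left, r1, r0]
  have t1 : r (r (s 1)) = (Fin.last (2 * N)).castSucc := by
    rw [hs, Equiv.swap_apply_right, r0, rl]
  have t2 : ∀ i : Fin (2 * N), r (r (s i.succ.succ)) = i.castSucc.castSucc := by
    intro i
    rw [hs, Equiv.swap_apply_of_ne_of_ne (Fin.succ_ne_zero _)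
      (by rw [← Fin.succ_zero_eq_one, Ne, Fin.succ_inj]; exact Fin.succ_ne_zero _), hr,
      finRotate_symm_succ, ← Fin.succ_castSucc, finRotate_symm_succ]
  have h3 := pf_expand (A'.submatrix s s) (fun i j => by
      simp only [hA', Matrix.submatrix_apply]; exact hA _ _) (fun j hj => by
      simp only [hA', Matrix.submatrix_apply, t0]
      refine h0 _ fun h => hj ?_
      rw [← t1] at h
      exact s.injective (r.injective (r.injective h)))
  have h4 : (A'.submatrix s s).submatrix (fun i : Fin (2 * N) => i.succ.succ)
      (fun i : Fin (2 * N) => i.succ.succ) = A.submatrix (fun i : Fin (2 * N) =>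
        i.castSucc.castSucc) (fun i : Fin (2 * N) => i.castSucc.castSucc) := by
    ext i j
    simp only [hA', Matrix.submatrix_apply, t2]
  rw [h4, h2, h1] at h3
  simp only [hA', Matrix.submatrix_apply, t0, t1] at h3
  rw [hA]
  linarith

/-- The matrix `E` bordered by a last column `y` and a last row `-y`. -/
def bord {n : ℕ} (E : Matrix (Fin n) (Fin n) ℝ) (y : Fin n → ℝ) :
    Matrix (Fin (n + 1)) (Fin (n + 1)) ℝ :=
  Matrix.of fun i j => Fin.lastCases (motive := fun _ => ℝ)
    (Fin.lastCases (motive := fun _ => ℝ) 0 (fun j => -y j) j)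
    (fun i => Fin.lastCases (motive := fun _ => ℝ) (y i) (fun j => E i j) j) i

@[simp] theorem bord_castSucc_castSucc {n : ℕ} (E : Matrix (Fin n) (Fin n) ℝ) (y : Fin n → ℝ)
    (i j : Fin n) : bord E y i.castSucc j.castSucc = E i j := by
  simp [bord]

@[simp] theorem bord_castSucc_last {n : ℕ} (E : Matrix (Fin n) (Fin n) ℝ) (y : Fin n → ℝ)
    (i : Fin n) : bord E y i.castSucc (Fin.last n) = y i := by
  simp [bord]

@[simp] theorem bord_last_castSucc {n : ℕ} (E : Matrix (Fin n) (Fin n) ℝ) (y : Fin n → ℝ)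
    (i : Fin n) : bord E y (Fin.last n) i.castSucc = -y i := by
  simp [bord]

@[simp] theorem bord_last_last {n : ℕ} (E : Matrix (Fin n) (Fin n) ℝ) (y : Fin n → ℝ) :
    bord E y (Fin.last n) (Fin.last n) = 0 := by
  simp [bord]

theorem bord_skew {n : ℕ} {E : Matrix (Fin n) (Fin n) ℝ} (hE : ∀ i j, E i j = -E j i)
    (y : Fin n → ℝ) (i j : Fin (n + 1)) : bord E y i j = -bord E y j i := by
  refine Fin.lastCases ?_ (fun i => ?_) i <;> refine Fin.lastCases ?_ (fun j => ?_) j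
  · simp
  · simp
  · simp
  · simpa using hE i j

/-- The Pfaffian of a bordered matrix, as a linear function of the border. -/
noncomputable def bordPf {N : ℕ} (E : Matrix (Fin (2 * N + 1)) (Fin (2 * N + 1)) ℝ) :
    (Fin (2 * N + 1) → ℝ) →ₗ[ℝ] ℝ where
  toFun y := pf (N := N + 1) (bord E y)
  map_add' y z := by
    have h : ∀ i : Fin (2 * N + 1 + 1), i ≠ Fin.last _ → ∃ k : Fin (2 * N + 1), k.castSucc = i :=
      fun i hi => Fin.exists_castSucc_eq.2 hi
    have := pf_linear (N := N + 1) (A := bord E (y + z)) (A₁ := bord E y) (A₂ := bord E z)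
      (Fin.last (2 * N + 1)) 1 1
      (fun i j hi hj => by
        obtain ⟨i, rfl⟩ := h i hi; obtain ⟨j, rfl⟩ := h j hj; simp)
      (fun i j hi hj => by
        obtain ⟨i, rfl⟩ := h i hi; obtain ⟨j, rfl⟩ := h j hj; simp)
      (fun i hi => by obtain ⟨i, rfl⟩ := h i hi; simp)
      (fun i hi => by obtain ⟨i, rfl⟩ := h i hi; simp; ring)
    rw [this]; ring
  map_smul' c y := by
    have h : ∀ i : Fin (2 * N + 1 + 1), i ≠ Fin.last _ → ∃ k : Fin (2 * N + 1), k.castSucc = i :=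
      fun i hi => Fin.exists_castSucc_eq.2 hi
    have := pf_linear (N := N + 1) (A := bord E (c • y)) (A₁ := bord E y) (A₂ := bord E y)
      (Fin.last (2 * N + 1)) c 0
      (fun i j hi hj => by
        obtain ⟨i, rfl⟩ := h i hi; obtain ⟨j, rfl⟩ := h j hj; simp)
      (fun i j hi hj => by
        obtain ⟨i, rfl⟩ := h i hi; obtain ⟨j, rfl⟩ := h j hj; simp)
      (fun i hi => by obtain ⟨i, rfl⟩ := h i hi; simp)
      (fun i hi => by obtain ⟨i, rfl⟩ := h i hi; simp)
    rw [this]; simp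

theorem bordPf_apply {N : ℕ} (E : Matrix (Fin (2 * N + 1)) (Fin (2 * N + 1)) ℝ)
    (y : Fin (2 * N + 1) → ℝ) : bordPf E y = pf (N := N + 1) (bord E y) := rfl

theorem bordPf_eq_sum {N : ℕ} (E : Matrix (Fin (2 * N + 1)) (Fin (2 * N + 1)) ℝ)
    (y : Fin (2 * N + 1) → ℝ) : bordPf E y = ∑ i, y i * bordPf E (Pi.single i 1) := by
  conv_lhs => rw [LinearMap.pi_apply_eq_sum_univ (bordPf E) y]
  refine Finset.sum_congr rfl fun i _ => ?_
  rw [smul_eq_mul]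
  congr 2
  ext j
  simp [Pi.single_apply, eq_comm]

/-- A unit border at the last index deletes that index; this computes the leading coefficient of the
numerators of P_n. -/
theorem bordPf_single_last {N : ℕ} {E : Matrix (Fin (2 * N + 1)) (Fin (2 * N + 1)) ℝ}
    (hE : ∀ i j, E i j = -E j i) : bordPf E (Pi.single (Fin.last _) 1) =
      pf (E.submatrix (Fin.castSucc : Fin (2 * N) → _) Fin.castSucc) := by
  rw [bordPf_apply, pf_expand_last _ (bord_skew hE _)]
  · rw [bord_castSucc_last, Pi.single_eq_same, one_mul]
    congr 1
    ext i j
    simp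
  · intro j
    refine Fin.lastCases ?_ (fun j => ?_) j
    · simp
    · intro hj
      rw [bord_last_castSucc, Pi.single_eq_of_ne, neg_zero]
      exact fun h => hj (by rw [h])

/-- A unit border at index 0 deletes that index: the sign of the rotation cancels against the entry
-1 of the moved row. This will remove the label d_0. -/
theorem bordPf_single_zero {N : ℕ} {E : Matrix (Fin (2 * N + 1)) (Fin (2 * N + 1)) ℝ}
    (hE : ∀ i j, E i j = -E j i) : bordPf E (Pi.single 0 1) =
      pf (E.submatrix (Fin.succ : Fin (2 * N) → _) Fin.succ) := by
  have r1 : (finRotate (2 * N + 1 + 1)).symm 1 = 0 := by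
    rw [← Fin.succ_zero_eq_one, finRotate_symm_succ, Fin.castSucc_zero]
  set A : Matrix (Fin (2 * N + 1 + 1)) (Fin (2 * N + 1 + 1)) ℝ := bord E (Pi.single 0 1) with hA
  set r := (finRotate (2 * N + 1 + 1)).symm with hr
  have r0 : r 0 = Fin.last _ := finRotate_symm_zero _
  have h01 : A.submatrix r r 0 1 = -1 := by
    rw [Matrix.submatrix_apply, r0, r1, ← Fin.castSucc_zero, hA, bord_last_castSucc,
      Pi.single_eq_same]
  have h := pf_expand (A.submatrix r r) (fun i j => bord_skew hE _ _ _) (by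
    intro j hj
    rw [Matrix.submatrix_apply, r0]
    have hj' : r j ≠ 0 := by
      rw [← r1]; exact fun h => hj (r.injective h)
    revert hj'
    refine Fin.lastCases ?_ (fun k => ?_) (r j)
    · simp [hA]
    · intro hk
      rw [hA, bord_last_castSucc, Pi.single_eq_of_ne, neg_zero]
      exact fun h => hk (by rw [h]; rfl))
  have h' : (A.submatrix r r).submatrix (fun i : Fin (2 * N) => i.succ.succ)
      (fun i : Fin (2 * N) => i.succ.succ) = E.submatrix Fin.succ Fin.succ := by
    ext i j
    simp only [Matrix.submatrix_apply, hr, finRotate_symm_succ, hA, bord_castSucc_castSucc]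
  rw [h', h01, hr, pf_submatrix_finRotate_symm] at h
  rw [bordPf_apply]
  linarith

variable {α : Type*} {e : α → α → ℝ}

theorem pfWord_snoc (he : ∀ a b, e a b = -e b a) {N : ℕ} (s : Fin (2 * N + 1) → α) (a : α) :
    pfWord (N := N + 1) e (Fin.snoc (α := fun _ => α) s a) =
      bordPf (Matrix.of fun i j => e (s i) (s j)) fun i => e (s i) a := by
  rw [bordPf_apply, pfWord]
  congr 1
  ext i j
  rw [Matrix.of_apply]
  refine Fin.lastCases ?_ (fun i => ?_) i <;> refine Fin.lastCases ?_ (fun j => ?_) j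
  · simpa using eq_zero_of_neg_eq (he a a).symm
  · simpa using he _ _
  · simp
  · simp

/-- The border is the column of a label already in the word, so that label is repeated. This is the
source of the orthogonality relations. -/
theorem pfWord_snoc_of_mem (he : ∀ a b, e a b = -e b a) {N : ℕ} (s : Fin (2 * N + 1) → α)
    (k : Fin (2 * N + 1)) :
    bordPf (Matrix.of fun i j => e (s i) (s j)) (fun i => e (s i) (s k)) = 0 := by
  rw [← pfWord_snoc he, pfWord]
  refine pf_eq_zero_of_eq _ (i := k.castSucc) (j := Fin.last (2 * N + 1))
    (Fin.castSucc_lt_last k).ne ?_ ?_ <;> intro i <;> simp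

/-- The label crosses an odd number of others. -/
theorem pfWord_snoc_eq_neg_cons {N : ℕ} (s : Fin (2 * N + 1) → α) (a : α) :
    pfWord (N := N + 1) e (Fin.snoc (α := fun _ => α) s a) =
      -pfWord (N := N + 1) e (Fin.cons (α := fun _ => α) a s) := by
  rw [pfWord, pfWord, ← pf_submatrix_finRotate]
  congr 1
  ext i j
  rw [Fin.snoc_eq_cons_rotate]
  rfl

end Wave

end BToda

namespace BToda

/-! ### Moments and leading coefficients of the numerators of P_n -/

section WaveFunctional

/-- The linear functional on polynomials with moments `a 0, a 1, …`. -/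
noncomputable def lin (a : ℕ → ℝ) : ℝ[X] →ₗ[ℝ] ℝ :=
  Polynomial.lsum fun i => LinearMap.toSpanSingleton ℝ ℝ (a i)

theorem lin_C_mul_X_pow (a : ℕ → ℝ) (c : ℝ) (i : ℕ) : lin a (C c * X ^ i) = c * a i := by
  rw [C_mul_X_pow_eq_monomial, lin, Polynomial.lsum_apply, Polynomial.sum_monomial_index] <;> simp

theorem lin_X_pow (a : ℕ → ℝ) (i : ℕ) : lin a (X ^ i) = a i := by
  simpa using lin_C_mul_X_pow a 1 i

theorem lin_eq_sum (a : ℕ → ℝ) {p : ℝ[X]} {n : ℕ} (h : p.natDegree < n) :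
    lin a p = ∑ i ∈ Finset.range n, p.coeff i * a i := by
  conv_lhs => rw [p.as_sum_range_C_mul_X_pow' h]
  simp only [map_sum, lin_C_mul_X_pow]

/-- The entry `Pf(a, z)`. -/
noncomputable def zEntry : Label → ℝ[X]
  | .idx i => X ^ i
  | .d0 => 0

/-- The Pfaffian `Pf(s, z)` for a word `s` of labels. -/
noncomputable def waveWord (ρ : ℝ → ℝ) (t : ℝ) {N : ℕ} (s : Fin (2 * N + 1) → Label) : ℝ[X] :=
  pfWord (N := N + 1) (entryZ ρ t)
    (Fin.snoc (α := fun _ => Option Label) (fun k => some (s k)) none)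

variable {ρ : ℝ → ℝ} {t : ℝ}

/-- Linearity in the column of z. Evaluating at real z reduces the claim to real Pfaffians, for
which linearity in the border is available. -/
theorem waveWord_eq_sum {N : ℕ} (s : Fin (2 * N + 1) → Label) :
    waveWord ρ t s = ∑ i, C (bordPf (Matrix.of fun i j => entry ρ t (s i) (s j))
      (Pi.single i 1)) * zEntry (s i) := by
  refine Polynomial.funext fun z => ?_
  have h1 : (waveWord ρ t s).eval z = bordPf (Matrix.of fun i j => entry ρ t (s i) (s j))
      fun i => (zEntry (s i)).eval z := by
    rw [waveWord, pfWord, ← coe_evalRingHom, map_pf, bordPf_apply]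
    congr 1
    ext i j
    rw [Matrix.map_apply, Matrix.of_apply]
    refine Fin.lastCases ?_ (fun i => ?_) i <;> refine Fin.lastCases ?_ (fun j => ?_) j
    · simp [entryZ]
    · rw [Fin.snoc_last, Fin.snoc_castSucc, bord_last_castSucc]
      cases s j <;> simp [entryZ, zEntry]
    · rw [Fin.snoc_last, Fin.snoc_castSucc, bord_castSucc_last]
      cases s i <;> simp [entryZ, zEntry]
    · simp [entryZ]
  rw [h1, bordPf_eq_sum, eval_finsetSum]
  refine Finset.sum_congr rfl fun i _ => ?_
  rw [eval_mul, eval_C, mul_comm]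

/-- Applying a moment functional replaces the column of powers of z by the column of moments, so
pairings with the numerators are again Pfaffians. -/
theorem lin_waveWord {N : ℕ} (s : Fin (2 * N + 1) → Label) (a : ℕ → ℝ) :
    lin a (waveWord ρ t s) = bordPf (Matrix.of fun i j => entry ρ t (s i) (s j))
      fun i => lin a (zEntry (s i)) := by
  rw [waveWord_eq_sum, map_sum, bordPf_eq_sum]
  refine Finset.sum_congr rfl fun i _ => ?_
  rw [← smul_eq_C_mul, map_smul, smul_eq_mul, mul_comm]

/-- The numerator of `P_n`. -/
noncomputable def wave (ρ : ℝ → ℝ) (n : ℕ) (t : ℝ) : ℝ[X] :=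
  if Even n then waveEven ρ (n / 2) t else waveOdd ρ (n / 2) t

theorem psop_eq (ρ : ℝ → ℝ) (n : ℕ) (t : ℝ) : psop ρ n t = C (tau ρ n t)⁻¹ * wave ρ n t := rfl

/-- The labels `d_0, 0, 1, …`. -/
def oddLabel : ℕ → Label
  | 0 => .d0
  | k + 1 => .idx k

theorem wave_two_mul (m : ℕ) :
    wave ρ (2 * m) t = waveWord (N := m) ρ t fun k => .idx k.val := by
  rw [wave, if_pos (even_two_mul m), Nat.mul_div_cancel_left m (by norm_num)]
  rfl

theorem wave_two_mul_add_one (m : ℕ) :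
    wave ρ (2 * m + 1) t = waveWord (N := m + 1) ρ t fun k => oddLabel k.val := by
  rw [wave, if_neg (by simp), show (2 * m + 1) / 2 = m by omega, waveOdd, waveWord]
  congr 1
  rw [Fin.cons_snoc_eq_snoc_cons]
  congr 1
  ext1 k
  refine Fin.cases ?_ (fun k => ?_) k <;> rfl

theorem tau_two_mul (m : ℕ) : tau ρ (2 * m) t =
    pfWord (N := m) (entry ρ t) fun k => .idx k.val := by
  rw [tau, if_pos (even_two_mul m), Nat.mul_div_cancel_left m (by norm_num)]
  rfl

theorem tau_two_mul_add_one (m : ℕ) : tau ρ (2 * m + 1) t =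
    pfWord (N := m + 1) (entry ρ t) fun k => oddLabel k.val := by
  rw [tau, if_neg (by simp), show (2 * m + 1) / 2 = m by omega, tauOdd]
  congr 1
  ext1 k
  refine Fin.cases (motive := fun k : Fin (2 * m + 1 + 1) => Fin.cons (α := fun _ => Label)
    Label.d0 (fun k : Fin (2 * m + 1) => Label.idx k) k = oddLabel k.val) ?_ (fun k => ?_) k <;> rfl

theorem tau_zero : tau ρ 0 t = 1 := by
  rw [← mul_zero 2, tau_two_mul]
  simp [pfWord, pf]

theorem natDegree_waveWord_le {N n : ℕ} (s : Fin (2 * N + 1) → Label)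
    (hs : ∀ i, (zEntry (s i)).natDegree ≤ n) : (waveWord ρ t s).natDegree ≤ n := by
  rw [waveWord_eq_sum]
  exact natDegree_sum_le_of_forall_le _ _ fun i _ => (natDegree_C_mul_le _ _).trans (hs i)

theorem natDegree_wave_le (n : ℕ) : (wave ρ n t).natDegree ≤ n := by
  obtain ⟨m, rfl | rfl⟩ := n.even_or_odd'
  · rw [wave_two_mul]
    refine natDegree_waveWord_le _ fun i => ?_
    simp only [zEntry, natDegree_X_pow]
    omega
  · rw [wave_two_mul_add_one]
    refine natDegree_waveWord_le (N := m + 1) _ fun ⟨i, hi⟩ => ?_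
    cases i with
    | zero => simp [oddLabel, zEntry]
    | succ i =>
      simp only [oddLabel, zEntry, natDegree_X_pow]
      omega

section Skew

variable (hsk : ∀ a b, entry ρ t a b = -entry ρ t b a)
include hsk

theorem coeff_waveWord_last {N k : ℕ} (f : ℕ → Label)
    (hf : ∀ i, i < 2 * N + 1 → (zEntry (f i)).coeff k = if i = 2 * N then 1 else 0) :
    (waveWord (N := N) ρ t fun i => f i.val).coeff k =
      pfWord (N := N) (entry ρ t) fun i => f i.val := by
  rw [waveWord_eq_sum, finsetSum_coeff, Finset.sum_eq_single (Fin.last _)]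
  · have h := bordPf_single_last (E := Matrix.of fun i j : Fin (2 * N + 1) =>
      entry ρ t (f i) (f j)) fun i j => hsk _ _
    rw [h, coeff_C_mul, hf _ (Fin.last (2 * N)).isLt, if_pos (by simp), mul_one]
    rfl
  · intro i _ hi
    rw [coeff_C_mul, hf _ i.isLt, if_neg, mul_zero]
    exact fun h => hi (Fin.ext h)
  · simp

theorem coeff_wave_self (n : ℕ) : (wave ρ n t).coeff n = tau ρ n t := by
  obtain ⟨m, rfl | rfl⟩ := n.even_or_odd'
  · rw [wave_two_mul, tau_two_mul]
    refine coeff_waveWord_last hsk _ fun i _ => ?_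
    rw [zEntry, coeff_X_pow]
    simp only [eq_comm]
  · rw [wave_two_mul_add_one, tau_two_mul_add_one]
    refine coeff_waveWord_last (N := m + 1) hsk _ fun i _ => ?_
    cases i with
    | zero => simp [oddLabel, zEntry]
    | succ i =>
      rw [oddLabel, zEntry, coeff_X_pow]
      congr 1
      rw [eq_iff_iff]
      omega

/-- Up to sign, the moments β_i form the column of the label d_0. For even n this appends d_0 and
gives the next tau function; for odd n the label d_0 is repeated. -/
theorem lin_beta_wave (n : ℕ) :
    lin (beta ρ t) (wave ρ n t) = if Even n then tau ρ (n + 1) t else 0 := by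
  obtain ⟨m, rfl | rfl⟩ := n.even_or_odd'
  · have h := pfWord_snoc_eq_neg_cons (N := m) (e := entry ρ t) (fun i => .idx i.val) .d0
    have h' : tau ρ (2 * m + 1) t = pfWord (N := m + 1) (entry ρ t)
        (Fin.cons (α := fun _ => Label) .d0 fun i : Fin (2 * m + 1) => .idx i.val) := by
      rw [tau, if_neg (by simp), show (2 * m + 1) / 2 = m by omega]
      rfl
    rw [wave_two_mul, h', lin_waveWord, if_pos (even_two_mul m), ← neg_neg (pfWord _ _), ← h,
      pfWord_snoc hsk, ← map_neg]
    congr 1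
    ext i
    simp [zEntry, lin_X_pow, entry]
  · rw [wave_two_mul_add_one, lin_waveWord (N := m + 1), if_neg (by simp)]
    have h := pfWord_snoc_of_mem (N := m + 1) hsk (fun i => oddLabel i.val) 0
    rw [← neg_eq_zero, ← map_neg, ← h]
    congr 1
    ext ⟨i, hi⟩
    cases i with
    | zero => simp [oddLabel, zEntry, entry]
    | succ i => simp [oddLabel, zEntry, entry, lin_X_pow]

/-- For even n the moments form the column of the label j, which is present since j ≤ n. For odd n
they differ from that column only at d_0, where z contributes 0 instead of β_j; this difference is a
multiple of a unit border, which deletes d_0 and produces τ_{n+1}. -/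
theorem lin_mu_wave (n j : ℕ) (hj : j ≤ n) :
    lin (fun i => mu ρ t i j) (wave ρ n t) =
      if Even n then 0 else -(beta ρ t j * tau ρ (n + 1) t) := by
  obtain ⟨m, rfl | rfl⟩ := n.even_or_odd'
  · rw [wave_two_mul, lin_waveWord, if_pos (even_two_mul m)]
    have h := pfWord_snoc_of_mem (N := m) hsk (fun i => .idx i.val) ⟨j, by omega⟩
    rw [← h]
    congr 1
    ext i
    simp [zEntry, lin_X_pow, entry]
  · rw [wave_two_mul_add_one, lin_waveWord (N := m + 1), if_neg (by simp)]
    have h := pfWord_snoc_of_mem (N := m + 1) hsk (fun i => oddLabel i.val) ⟨j + 1, by omega⟩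
    have h0 := bordPf_single_zero (N := m + 1)
      (E := Matrix.of fun i j => entry ρ t (oddLabel i.val) (oddLabel j.val))
      fun i j => hsk _ _
    have h1 : tau ρ (2 * m + 1 + 1) t = bordPf (N := m + 1) (Matrix.of fun i j =>
        entry ρ t (oddLabel i.val) (oddLabel j.val)) (Pi.single 0 1) :=
      (tau_two_mul (m + 1)).trans h0.symm
    have h2 : (fun i : Fin (2 * (m + 1) + 1) => lin (fun i => mu ρ t i j) (zEntry (oddLabel i))) =
        (fun i : Fin (2 * (m + 1) + 1) => entry ρ t (oddLabel i) (oddLabel (j + 1))) - beta ρ t j • Pi.single 0 1 := by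
      ext ⟨i, hi⟩
      cases i with
      | zero => simp [oddLabel, zEntry, entry]
      | succ i =>
        rw [Pi.sub_apply, Pi.smul_apply, Pi.single_eq_of_ne (by simp)]
        simp [oddLabel, zEntry, entry, lin_X_pow]
    rw [h1, h2, map_sub, map_smul, smul_eq_mul]
    simp only at h
    rw [h, zero_sub]

end Skew

section Differentiable

theorem differentiableAt_pf {N : ℕ} {A : ℝ → Matrix (Fin (2 * N)) (Fin (2 * N)) ℝ} {t : ℝ}
    (h : ∀ i j, DifferentiableAt ℝ (fun s => A s i j) t) :
    DifferentiableAt ℝ (fun s => pf (A s)) t := by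
  unfold pf
  refine DifferentiableAt.fun_const_smul ?_ _
  refine DifferentiableAt.fun_sum fun σ _ => ?_
  refine DifferentiableAt.const_mul ?_ _
  exact DifferentiableAt.fun_finsetProd fun l _ => h _ _

variable (hd : ∀ a b, DifferentiableAt ℝ (fun s => entry ρ s a b) t)
include hd

theorem differentiableAt_tau (n : ℕ) : DifferentiableAt ℝ (tau ρ n) t := by
  obtain ⟨m, rfl | rfl⟩ := n.even_or_odd'
  · rw [show tau ρ (2 * m) = _ from funext fun s => tau_two_mul m]
    exact differentiableAt_pf fun i j => hd (.idx i.val) (.idx j.val)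
  · rw [show tau ρ (2 * m + 1) = _ from funext fun s => tau_two_mul_add_one m]
    exact differentiableAt_pf fun i j => hd (oddLabel i.val) (oddLabel j.val)

theorem differentiableAt_coeff_waveWord {N : ℕ} (s : Fin (2 * N + 1) → Label) (k : ℕ) :
    DifferentiableAt ℝ (fun r => (waveWord ρ r s).coeff k) t := by
  simp only [waveWord_eq_sum, finsetSum_coeff, coeff_C_mul]
  refine DifferentiableAt.fun_sum fun i _ => DifferentiableAt.mul_const ?_ _
  simp only [bordPf_apply]
  refine differentiableAt_pf (N := N + 1) fun i j => ?_
  refine Fin.lastCases ?_ (fun i => ?_) i <;> refine Fin.lastCases ?_ (fun j => ?_) j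
  · simp
  · simp
  · simp
  · simpa using hd _ _

theorem differentiableAt_coeff_wave (n k : ℕ) :
    DifferentiableAt ℝ (fun r => (wave ρ n r).coeff k) t := by
  obtain ⟨m, rfl | rfl⟩ := n.even_or_odd'
  · simp only [wave_two_mul]
    exact differentiableAt_coeff_waveWord hd _ k
  · simp only [wave_two_mul_add_one]
    exact differentiableAt_coeff_waveWord (N := m + 1) hd _ k

end Differentiable

end WaveFunctional

end BToda

namespace BToda

/-! ### Matching the signs of a continuous function by a polynomial -/

section SignChanges

theorem exists_sign_of_ne_zero {F : ℝ → ℝ} {S : Set ℝ} (hS : S.OrdConnected)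
    (hF : ContinuousOn F S) (hne : ∀ x ∈ S, F x ≠ 0) :
    ∃ σ : ℝ, (σ = 1 ∨ σ = -1) ∧ ∀ x ∈ S, 0 < σ * F x := by
  by_cases h : ∃ x ∈ S, F x < 0
  · obtain ⟨x, hx, hFx⟩ := h
    refine ⟨-1, Or.inr rfl, fun y hy => ?_⟩
    by_contra hy'
    have h0 : (0 : ℝ) ∈ F '' S :=
      hS.isPreconnected.intermediate_value hx hy hF ⟨hFx.le, by linarith⟩
    obtain ⟨z, hz, hz0⟩ := h0
    exact hne z hz hz0
  · push Not at h
    exact ⟨1, Or.inl rfl, fun x hx => by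
      rw [one_mul]; exact lt_of_le_of_ne (h x hx) (hne x hx).symm⟩

/-- Induction on the largest exceptional point `a`: on each side of it a sign pattern is known, and
`a` joins the set `T` of sign changes exactly when the sign `ε` on the right differs from `σ`. -/
theorem exists_prod_mul_pos (F : ℝ → ℝ) (Z : Finset ℝ) : ∀ S : Set ℝ, S.OrdConnected →
    ContinuousOn F S → (∀ x ∈ S, x ∉ Z → F x ≠ 0) → ∃ σ : ℝ, (σ = 1 ∨ σ = -1) ∧ ∃ T ⊆ Z,
      ∀ x ∈ S, x ∉ Z → 0 < σ * (∏ s ∈ T, (x - s)) * F x := by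
  induction Z using Finset.induction_on_max with
  | empty =>
    intro S hS hF hne
    obtain ⟨σ, hσ, h⟩ := exists_sign_of_ne_zero hS hF fun x hx => hne x hx (by simp)
    exact ⟨σ, hσ, ∅, subset_rfl, fun x hx _ => by simpa using h x hx⟩
  | insert a Z ha ih =>
    intro S hS hF hne
    obtain ⟨σ, hσ, T, hT, h⟩ := ih (S ∩ Iio a) (hS.inter ordConnected_Iio)
      (hF.mono inter_subset_left) fun x hx hxZ => hne x hx.1 (by
        rw [Finset.mem_insert, not_or]; exact ⟨hx.2.ne, hxZ⟩)
    have haT : a ∉ T := fun h => lt_irrefl _ (ha a (hT h))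
    obtain ⟨ε, hε, h'⟩ := exists_sign_of_ne_zero (F := F) (hS.inter (ordConnected_Ioi (a := a)))
      (hF.mono inter_subset_left) fun x hx => hne x hx.1 (by
        rw [Finset.mem_insert, not_or]; exact ⟨hx.2.ne', fun h => lt_asymm (ha x h) hx.2⟩)
    have hprod : ∀ x, a < x → 0 < ∏ s ∈ T, (x - s) := fun x hx =>
      Finset.prod_pos fun s hs => by linarith [ha s (hT hs)]
    by_cases hεσ : ε = σ
    · refine ⟨σ, hσ, T, hT.trans (Finset.subset_insert _ _), fun x hx hxZ => ?_⟩
      rw [Finset.mem_insert, not_or] at hxZ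
      rcases lt_or_gt_of_ne hxZ.1 with hlt | hgt
      · exact h x ⟨hx, hlt⟩ hxZ.2
      · have h1 := mul_pos (h' x ⟨hx, hgt⟩) (hprod x hgt)
        rw [hεσ] at h1
        nlinarith
    · have hε' : ε = -σ := by
        rcases hσ with rfl | rfl <;> rcases hε with rfl | rfl <;> simp_all
      refine ⟨ε, hε, insert a T, Finset.insert_subset_insert _ hT, fun x hx hxZ => ?_⟩
      rw [Finset.mem_insert, not_or] at hxZ
      rw [Finset.prod_insert haT]
      rcases lt_or_gt_of_ne hxZ.1 with hlt | hgt
      · have h1 := mul_pos (h x ⟨hx, hlt⟩ hxZ.2) (sub_pos.2 hlt)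
        rw [hε']
        nlinarith
      · have h1 := mul_pos (mul_pos (h' x ⟨hx, hgt⟩) (hprod x hgt)) (sub_pos.2 hgt)
        nlinarith

/-- A continuous function on `(0, ∞)` with finitely many zeros has the same sign as some polynomial
of degree at most the number of zeros. -/
theorem exists_polynomial_mul_pos {F : ℝ → ℝ} (hF : ContinuousOn F (Ioi 0)) (Z : Finset ℝ)
    (hne : ∀ x, 0 < x → x ∉ Z → F x ≠ 0) :
    ∃ g : ℝ[X], g.natDegree ≤ Z.card ∧ ∀ x, 0 < x → x ∉ Z → 0 < g.eval x * F x := by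
  obtain ⟨σ, -, T, hT, h⟩ := exists_prod_mul_pos F Z (Ioi 0) ordConnected_Ioi hF hne
  refine ⟨C σ * ∏ s ∈ T, (X - C s), ?_, fun x hx hxZ => ?_⟩
  · refine (natDegree_C_mul_le _ _).trans ?_
    rw [natDegree_prod_of_monic _ _ fun s _ => monic_X_sub_C s]
    simpa using Finset.card_le_card hT
  · simpa [eval_prod] using h x hx hxZ

end SignChanges

/-! ### Moment functionals under the integral sign -/

section Functional

theorem lin_pow_mul (x c : ℝ) (q : ℝ[X]) : lin (fun i => x ^ i * c) q = q.eval x * c := by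
  rw [lin_eq_sum _ (Nat.lt_succ_self _), eval_eq_sum_range, Finset.sum_mul]
  exact Finset.sum_congr rfl fun i _ => by ring

theorem lin_add (a b : ℕ → ℝ) (q : ℝ[X]) :
    lin (fun i => a i + b i) q = lin a q + lin b q := by
  simp only [lin_eq_sum _ (Nat.lt_succ_self _), mul_add, Finset.sum_add_distrib]

theorem lin_mul_const (a : ℕ → ℝ) (c : ℝ) (q : ℝ[X]) :
    lin (fun i => a i * c) q = lin a q * c := by
  simp only [lin_eq_sum _ (Nat.lt_succ_self _), Finset.sum_mul, mul_assoc]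

theorem integrable_lin {α : Type*} [MeasurableSpace α] {ν : Measure α} {f : ℕ → α → ℝ}
    (hf : ∀ i, Integrable (f i) ν) (q : ℝ[X]) : Integrable (fun x => lin (fun i => f i x) q) ν := by
  simp only [lin_eq_sum _ (Nat.lt_succ_self q.natDegree)]
  exact integrable_finsetSum _ fun i _ => (hf i).const_mul _

theorem lin_integral {α : Type*} [MeasurableSpace α] {ν : Measure α} {f : ℕ → α → ℝ}
    (hf : ∀ i, Integrable (f i) ν) (q : ℝ[X]) :
    lin (fun i => ∫ x, f i x ∂ν) q = ∫ x, lin (fun i => f i x) q ∂ν := by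
  simp only [lin_eq_sum _ (Nat.lt_succ_self q.natDegree)]
  rw [integral_finsetSum _ fun i _ => (hf i).const_mul _]
  simp only [integral_const_mul]

end Functional

/-! ### The moments: Cauchy kernel, nondegeneracy and time derivatives -/

section Moments

/-- Lebesgue measure on `(0, ∞)`. -/
noncomputable abbrev posVol : Measure ℝ := volume.restrict (Ioi 0)

theorem ae_pos : ∀ᵐ x ∂posVol, 0 < x := ae_restrict_mem measurableSet_Ioi

theorem posVol_prod : posVol.prod posVol =
    (volume : Measure (ℝ × ℝ)).restrict (Ioi (0 : ℝ) ×ˢ Ioi (0 : ℝ)) := by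
  rw [Measure.prod_restrict, Measure.volume_eq_prod]

theorem ae_prod_pos : ∀ᵐ p ∂(posVol.prod posVol), 0 < p.1 ∧ 0 < p.2 := by
  rw [posVol_prod]
  filter_upwards [ae_restrict_mem (measurableSet_Ioi.prod measurableSet_Ioi)] with p hp
  exact hp

/-- The moment integrand `x^i exp(tx) ρ(x)`. -/
noncomputable def wt (ρ : ℝ → ℝ) (t : ℝ) (i : ℕ) (x : ℝ) : ℝ := x ^ i * Real.exp (t * x) * ρ x

variable {ρ : ℝ → ℝ} {t : ℝ}

theorem beta_eq (i : ℕ) : beta ρ t i = ∫ x, wt ρ t i x ∂posVol := rfl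

theorem mu_eq (i j : ℕ) : mu ρ t i j = ∫ p, (p.1 - p.2) / (p.1 + p.2) *
    (wt ρ t i p.1 * wt ρ t j p.2) ∂(posVol.prod posVol) := by
  rw [mu, posVol_prod]
  congr 1
  ext p
  simp only [wt, mul_add, Real.exp_add]
  ring

theorem wt_succ (i : ℕ) (x : ℝ) : wt ρ t (i + 1) x = x * wt ρ t i x := by
  simp only [wt, pow_succ]; ring

theorem wt_eq (i : ℕ) (x : ℝ) : wt ρ t i x = x ^ i * wt ρ t 0 x := by
  simp only [wt, pow_zero]; ring

theorem mu_skew (i j : ℕ) : mu ρ t i j = -mu ρ t j i := by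
  rw [mu_eq, mu_eq, ← integral_neg, ← integral_prod_swap]
  congr 1
  ext p
  simp only [Prod.fst_swap, Prod.snd_swap]
  rw [show p.2 - p.1 = -(p.1 - p.2) by ring, add_comm p.2]
  ring

theorem entry_skew (a b : Label) : entry ρ t a b = -entry ρ t b a := by
  cases a <;> cases b <;> simp [entry]
  exact mu_skew _ _

section Integrals

variable (hw : ∀ i, Integrable (wt ρ t i) posVol)
include hw

theorem integrable_wt_prod (i j : ℕ) :
    Integrable (fun p : ℝ × ℝ => wt ρ t i p.1 * wt ρ t j p.2) (posVol.prod posVol) :=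
  (hw i).mul_prod (hw j)

theorem integrable_mu (i j : ℕ) : Integrable (fun p : ℝ × ℝ => (p.1 - p.2) / (p.1 + p.2) *
    (wt ρ t i p.1 * wt ρ t j p.2)) (posVol.prod posVol) := by
  refine (integrable_wt_prod hw i j).bdd_mul (c := 1)
    (Measurable.aestronglyMeasurable (by fun_prop)) ?_
  filter_upwards [ae_prod_pos] with p hp
  obtain ⟨h1, h2⟩ := hp
  rw [Real.norm_eq_abs, abs_div, abs_of_pos (add_pos h1 h2), div_le_one (add_pos h1 h2), abs_le]
  constructor <;> linarith

omit hw in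
theorem integral_wt_prod (i j : ℕ) : ∫ p, wt ρ t i p.1 * wt ρ t j p.2 ∂(posVol.prod posVol) =
    beta ρ t i * beta ρ t j := by
  rw [integral_prod_mul, beta_eq, beta_eq]

/-- The factor x + y cancels the denominator, leaving the separable kernel x - y. -/
theorem mu_succ_add (i j : ℕ) : mu ρ t (i + 1) j + mu ρ t i (j + 1) =
    beta ρ t (i + 1) * beta ρ t j - beta ρ t i * beta ρ t (j + 1) := by
  rw [mu_eq, mu_eq, ← integral_add (integrable_mu hw _ _) (integrable_mu hw _ _),
    ← integral_wt_prod, ← integral_wt_prod,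
    ← integral_sub (integrable_wt_prod hw _ _) (integrable_wt_prod hw _ _)]
  refine integral_congr_ae ?_
  filter_upwards [ae_prod_pos] with p hp
  obtain ⟨h1, h2⟩ := hp
  have : p.1 + p.2 ≠ 0 := by positivity
  simp only [wt_succ]
  field_simp

/-- `K_i(y) = ∫_{x>0} x/(x+y) x^i exp(tx) ρ(x) dx`. -/
noncomputable def cauchyK (ρ : ℝ → ℝ) (t : ℝ) (i : ℕ) (y : ℝ) : ℝ :=
  ∫ x, x / (x + y) * wt ρ t i x ∂posVol

theorem integrable_cauchyK {y : ℝ} (hy : 0 < y) (i : ℕ) :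
    Integrable (fun x => x / (x + y) * wt ρ t i x) posVol := by
  refine (hw i).bdd_mul (c := 1) (Measurable.aestronglyMeasurable (by fun_prop)) ?_
  filter_upwards [ae_pos] with x hx
  rw [Real.norm_eq_abs, abs_of_pos (by positivity), div_le_one (by positivity)]
  linarith

theorem continuousOn_cauchyK (i : ℕ) : ContinuousOn (cauchyK ρ t i) (Ioi 0) := by
  refine continuousOn_of_dominated (bound := fun x => ‖wt ρ t i x‖)
    (fun y hy => (integrable_cauchyK hw hy i).aestronglyMeasurable) (fun y hy => ?_)
    (hw i).norm ?_
  · filter_upwards [ae_pos] with x hx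
    have hy : 0 < y := hy
    rw [norm_mul, Real.norm_eq_abs (x / (x + y)), abs_of_pos (by positivity)]
    refine mul_le_of_le_one_left (norm_nonneg _) ?_
    rw [div_le_one (by positivity)]
    linarith
  · filter_upwards [ae_pos] with x hx
    refine ContinuousOn.mul (ContinuousOn.div continuousOn_const (by fun_prop) ?_)
      continuousOn_const
    intro y hy
    have hy : 0 < y := hy
    positivity

/-- The kernel x/(x+y) is the mean of 1 and (x-y)/(x+y). -/
theorem integrable_kernel (i j : ℕ) : Integrable (fun p : ℝ × ℝ =>
    wt ρ t j p.2 * (p.1 / (p.1 + p.2) * wt ρ t i p.1)) (posVol.prod posVol) := by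
  have h := ((integrable_wt_prod hw i j).add (integrable_mu hw i j)).div_const 2
  refine h.congr ?_
  filter_upwards [ae_prod_pos] with p hp
  obtain ⟨h1, h2⟩ := hp
  have : p.1 + p.2 ≠ 0 := by positivity
  simp only [Pi.add_apply]
  field_simp
  ring

theorem integrable_wt_mul_cauchyK (i j : ℕ) :
    Integrable (fun y => wt ρ t j y * cauchyK ρ t i y) posVol := by
  refine (integrable_kernel hw i j).integral_prod_right.congr (Filter.Eventually.of_forall ?_)
  intro y
  simp only [cauchyK, integral_const_mul]

/-- Fubini, after 1 + (x-y)/(x+y) = 2x/(x+y). -/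
theorem mu_add_beta_mul (i j : ℕ) : mu ρ t i j + beta ρ t i * beta ρ t j =
    2 * ∫ y, wt ρ t j y * cauchyK ρ t i y ∂posVol := by
  have h := integral_prod_symm _ (integrable_kernel hw i j)
  simp only [integral_const_mul] at h
  simp only [cauchyK]
  rw [← h, mu_eq, ← integral_wt_prod, ← integral_add (integrable_mu hw _ _)
    (integrable_wt_prod hw _ _), ← integral_const_mul]
  refine integral_congr_ae ?_
  filter_upwards [ae_prod_pos] with p hp
  obtain ⟨h1, h2⟩ := hp
  have : p.1 + p.2 ≠ 0 := by positivity
  field_simp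
  ring

variable (hρ : ∀ x, 0 < x → 0 ≤ ρ x) (hne : ¬ (∀ᵐ x ∂posVol, ρ x = 0))
include hρ hne

-- The integrand is nonnegative almost everywhere, so a zero integral would make ρ vanish almost
-- everywhere; the finite set `Z` is negligible.
omit hw in
theorem integral_mul_wt_ne_zero {f : ℝ → ℝ} (Z : Finset ℝ) (hf : ∀ x, 0 < x → x ∉ Z → 0 < f x)
    (hint : Integrable (fun x => f x * wt ρ t 0 x) posVol) :
    ∫ x, f x * wt ρ t 0 x ∂posVol ≠ 0 := by
  have hZ : ∀ᵐ x ∂posVol, x ∉ Z := by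
    refine ae_restrict_of_ae ?_
    exact measure_eq_zero_iff_ae_notMem.1 (Z.finite_toSet.measure_zero volume)
  intro h
  rw [integral_eq_zero_iff_of_nonneg_ae ?_ hint] at h
  · refine hne ?_
    filter_upwards [h, hZ, ae_pos] with x hx hxZ hx0
    have h1 := hf x hx0 hxZ
    have h2 := Real.exp_pos (t * x)
    simpa [wt, h1.ne', h2.ne'] using hx
  · filter_upwards [hZ, ae_pos] with x hxZ hx0
    have h1 := hf x hx0 hxZ
    have h2 := Real.exp_pos (t * x)
    have h3 := hρ x hx0
    simp only [wt, pow_zero, one_mul, Pi.zero_apply]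
    positivity

/-- With more than deg q zeros, the functions 1/(x+y), y ∈ Z, could be combined into g/∏(x+y), where
g has the sign of q on the half-line. The same combination of the vanishing integrals would be ∫ x g
q w / ∏(x+y), which is nonzero. -/
theorem card_zeros_le {q : ℝ[X]} (hq : q ≠ 0) (Z : Finset ℝ) (hZ : ∀ y ∈ Z, 0 < y ∧
    lin (fun i => cauchyK ρ t i y) q = 0) : Z.card ≤ q.natDegree := by
  by_contra hcard
  push Not at hcard
  obtain ⟨g, hg, hpos⟩ := exists_polynomial_mul_pos (F := fun x => q.eval x) q.continuousOn
    q.roots.toFinset fun x _ hx h => hx (by simp [hq, h])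
  have hgdeg : g.degree < Z.card := by
    refine degree_le_natDegree.trans_lt ?_
    exact_mod_cast (hg.trans ((Multiset.toFinset_card_le _).trans (card_roots' q))).trans_lt hcard
  -- Lagrange interpolation of `g` at the nodes -y is its partial fraction expansion over ∏(x+y);
  -- the numbers `c y` are the residues.
  have hinj : Set.InjOn (fun y : ℝ => -y) Z := fun x _ y _ h => neg_injective h
  have hint := Lagrange.eq_interpolate_of_eval_eq (fun y => g.eval (-y)) hinj hgdeg fun _ _ => rfl
  set c : ℝ → ℝ := fun y => Lagrange.nodalWeight Z (fun y : ℝ => -y) y * g.eval (-y) with hc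
  set nd : ℝ → ℝ := fun x => (Lagrange.nodal Z fun y : ℝ => -y).eval x with hnd
  have hndpos : ∀ x, 0 < x → 0 < nd x := by
    intro x hx
    rw [hnd]
    simp only [Lagrange.eval_nodal]
    exact Finset.prod_pos fun y hy => by have := (hZ y hy).1; linarith
  have hpf : ∀ x, 0 < x → g.eval x = nd x * ∑ y ∈ Z, c y / (x + y) := by
    intro x hx
    conv_lhs => rw [hint]
    rw [Lagrange.eval_interpolate_not_at_node _ fun y hy => by
      have := (hZ y hy).1; intro h; linarith]
    congr 1
    refine Finset.sum_congr rfl fun y hy => ?_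
    simp only [hc, sub_neg_eq_add]
    ring
  have hF : ∀ y ∈ Z, Integrable (fun x => x / (x + y) * (q.eval x * wt ρ t 0 x)) posVol ∧
      ∫ x, x / (x + y) * (q.eval x * wt ρ t 0 x) ∂posVol = 0 := by
    intro y hy
    have e : ∀ x, lin (fun i => x / (x + y) * wt ρ t i x) q =
        x / (x + y) * (q.eval x * wt ρ t 0 x) := by
      intro x
      rw [mul_left_comm, ← lin_pow_mul]
      congr 2
      ext i
      rw [wt_eq]
      ring
    have h1 := integrable_lin (integrable_cauchyK hw (hZ y hy).1) q
    have h2 := lin_integral (integrable_cauchyK hw (hZ y hy).1) q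
    simp only [e] at h1 h2
    exact ⟨h1, h2.symm.trans (hZ y hy).2⟩
  have e : (fun x => ∑ y ∈ Z, c y * (x / (x + y) * (q.eval x * wt ρ t 0 x))) =ᵐ[posVol]
      fun x => (x / nd x * (g.eval x * q.eval x)) * wt ρ t 0 x := by
    filter_upwards [ae_pos] with x hx
    have := (hndpos x hx).ne'
    rw [hpf x hx]
    have e2 : ∑ y ∈ Z, c y * (x / (x + y) * (q.eval x * wt ρ t 0 x)) =
        (∑ y ∈ Z, c y / (x + y)) * (x * (q.eval x * wt ρ t 0 x)) := by
      rw [Finset.sum_mul]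
      exact Finset.sum_congr rfl fun y _ => by ring
    rw [e2]
    field_simp
  have hsum : Integrable (fun x => ∑ y ∈ Z, c y * (x / (x + y) * (q.eval x * wt ρ t 0 x))) posVol :=
    integrable_finsetSum _ fun y hy => (hF y hy).1.const_mul _
  refine integral_mul_wt_ne_zero hρ hne (f := fun x => x / nd x * (g.eval x * q.eval x))
    q.roots.toFinset (fun x hx hxZ => ?_) (hsum.congr e) ?_
  · exact mul_pos (div_pos hx (hndpos x hx)) (hpos x hx hxZ)
  · rw [← integral_congr_ae e, integral_finsetSum _ fun y hy => (hF y hy).1.const_mul _]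
    refine Finset.sum_eq_zero fun y hy => ?_
    rw [integral_const_mul, (hF y hy).2, mul_zero]

/-- The bilinear form `⟨p, q⟩ + β(p) β(q)` is non-degenerate on the polynomials of degree at most
`n`. -/
theorem form_nondegenerate {n : ℕ} {q : ℝ[X]} (hn : q.natDegree ≤ n)
    (h : ∀ j ≤ n, lin (fun i => mu ρ t i j + beta ρ t i * beta ρ t j) q = 0) : q = 0 := by
  by_contra hq
  set F : ℝ → ℝ := fun y => lin (fun i => cauchyK ρ t i y) q with hF
  have hFc : ContinuousOn F (Ioi 0) := by
    simp only [hF, lin_eq_sum _ (Nat.lt_succ_self q.natDegree)]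
    exact continuousOn_finsetSum _ fun i _ => continuousOn_const.mul (continuousOn_cauchyK hw i)
  -- An infinite zero set would contain deg q + 1 points.
  have hfin : {y | 0 < y ∧ F y = 0}.Finite := by
    by_contra hinf
    obtain ⟨Z, hZ, hcard⟩ := Set.Infinite.exists_subset_card_eq hinf (q.natDegree + 1)
    have := card_zeros_le hw hρ hne hq Z fun y hy => hZ hy
    omega
  have hcard : hfin.toFinset.card ≤ q.natDegree :=
    card_zeros_le hw hρ hne hq _ fun y hy => by simpa using hy
  -- The degree of `g` is at most the number of zeros of `F`, hence at most `n`, so the hypothesis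
  -- gives ∫ g F w = 0 although g F > 0 off a finite set.
  obtain ⟨g, hg, hpos⟩ := exists_polynomial_mul_pos hFc hfin.toFinset fun x hx hxZ h0 =>
    hxZ (by simp [hx, h0])
  have hj : ∀ j, Integrable (fun y => F y * wt ρ t j y) posVol ∧
      2 * ∫ y, F y * wt ρ t j y ∂posVol =
        lin (fun i => mu ρ t i j + beta ρ t i * beta ρ t j) q := by
    intro j
    have e : ∀ y, lin (fun i => wt ρ t j y * cauchyK ρ t i y) q = F y * wt ρ t j y := by
      intro y
      rw [hF]
      simp only [← lin_mul_const]
      congr 2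
      ext i
      ring
    have h1 := integrable_lin (fun i => integrable_wt_mul_cauchyK hw i j) q
    have h2 := lin_integral (fun i => integrable_wt_mul_cauchyK hw i j) q
    simp only [e] at h1 h2
    refine ⟨h1, ?_⟩
    simp only [mu_add_beta_mul hw, mul_comm (2 : ℝ)]
    rw [lin_mul_const, h2]
  have e : ∀ y, lin (fun j => F y * wt ρ t j y) g = (g.eval y * F y) * wt ρ t 0 y := by
    intro y
    rw [mul_assoc, ← lin_pow_mul]
    congr 2
    ext i
    rw [wt_eq]
    ring
  have h1 := integrable_lin (fun j => (hj j).1) g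
  have h2 := lin_integral (fun j => (hj j).1) g
  simp only [e] at h1 h2
  refine integral_mul_wt_ne_zero hρ hne hfin.toFinset hpos h1 ?_
  rw [← h2, lin_eq_sum _ (Nat.lt_succ_of_le ((hg.trans hcard).trans hn))]
  refine Finset.sum_eq_zero fun j hj' => ?_
  have h3 := (hj j).2
  rw [h j (Finset.mem_range_succ_iff.1 hj')] at h3
  rw [show ∫ y, F y * wt ρ t j y ∂posVol = 0 by linarith, mul_zero]

end Integrals

section Derivatives

variable {I : Set ℝ} (hI : IsOpen I) (hρ : ∀ x, 0 < x → 0 ≤ ρ x)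
  (hw : ∀ t ∈ I, ∀ i, Integrable (wt ρ t i) posVol)

theorem hasDerivAt_wt (i : ℕ) (s x : ℝ) :
    HasDerivAt (fun s => wt ρ s i x) (wt ρ s (i + 1) x) s := by
  have h := (((hasDerivAt_id s).mul_const x).exp.const_mul (x ^ i)).mul_const (ρ x)
  refine h.congr_deriv ?_
  simp only [wt, pow_succ, id, one_mul]
  ring

-- For x > 0 the weight increases with time, so its value at t + δ dominates it on the whole ball;
-- integrability there allows differentiation under the integral.
include hI in
theorem exists_ball_lt_mem (ht : t ∈ I) : ∃ δ > 0, Metric.ball t δ ⊆ I ∧ t + δ ∈ I := by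
  obtain ⟨ε, hε, h⟩ := Metric.isOpen_iff.1 hI t ht
  refine ⟨ε / 2, by positivity, (Metric.ball_subset_ball (by linarith)).trans h, h ?_⟩
  rw [Metric.mem_ball, Real.dist_eq]
  simp only [add_sub_cancel_left, abs_of_pos (half_pos hε)]
  linarith

include hρ in
theorem wt_nonneg (i : ℕ) (s : ℝ) {x : ℝ} (hx : 0 < x) : 0 ≤ wt ρ s i x := by
  have := hρ x hx
  have := Real.exp_pos (s * x)
  unfold wt
  positivity

include hρ in
theorem wt_mono (i : ℕ) {s r : ℝ} (h : s ≤ r) {x : ℝ} (hx : 0 < x) : wt ρ s i x ≤ wt ρ r i x := by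
  have := hρ x hx
  unfold wt
  gcongr

include hI hρ hw

theorem hasDerivAt_beta (ht : t ∈ I) (i : ℕ) :
    HasDerivAt (fun s => beta ρ s i) (beta ρ t (i + 1)) t := by
  obtain ⟨δ, hδ, hb, hδI⟩ := exists_ball_lt_mem hI ht
  refine (hasDerivAt_integral_of_dominated_loc_of_deriv_le (μ := posVol) (F := fun s => wt ρ s i)
    (F' := fun s => wt ρ s (i + 1)) (bound := wt ρ (t + δ) (i + 1)) (Metric.ball_mem_nhds t hδ)
    ?_ (hw t ht i) (hw t ht _).aestronglyMeasurable ?_ (hw _ hδI _)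
    (Filter.Eventually.of_forall fun x s _ => hasDerivAt_wt i s x)).2
  · filter_upwards [Metric.ball_mem_nhds t hδ] with s hs
    exact (hw s (hb hs) i).aestronglyMeasurable
  · filter_upwards [ae_pos] with x hx s hs
    rw [Real.norm_of_nonneg (wt_nonneg hρ _ _ hx)]
    rw [Metric.mem_ball, Real.dist_eq, abs_lt] at hs
    exact wt_mono hρ _ (by linarith) hx

/-- Differentiating the exponential produces x + y, so `mu_succ_add` applies to the derivative. -/
theorem hasDerivAt_mu (ht : t ∈ I) (i j : ℕ) : HasDerivAt (fun s => mu ρ s i j)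
    (beta ρ t (i + 1) * beta ρ t j - beta ρ t i * beta ρ t (j + 1)) t := by
  obtain ⟨δ, hδ, hb, hδI⟩ := exists_ball_lt_mem hI ht
  have h := (hasDerivAt_integral_of_dominated_loc_of_deriv_le (μ := posVol.prod posVol)
    (F := fun s p => (p.1 - p.2) / (p.1 + p.2) * (wt ρ s i p.1 * wt ρ s j p.2))
    (F' := fun s p => (p.1 - p.2) / (p.1 + p.2) *
      (wt ρ s (i + 1) p.1 * wt ρ s j p.2 + wt ρ s i p.1 * wt ρ s (j + 1) p.2))
    (bound := fun p => wt ρ (t + δ) (i + 1) p.1 * wt ρ (t + δ) j p.2 +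
      wt ρ (t + δ) i p.1 * wt ρ (t + δ) (j + 1) p.2) (Metric.ball_mem_nhds t hδ)
    ?_ (integrable_mu (hw t ht) i j) ?_ ?_ ?_ ?_).2
  · simp only [← mu_eq] at h
    refine h.congr_deriv ?_
    simp only [mul_add]
    rw [integral_add (integrable_mu (hw t ht) _ _) (integrable_mu (hw t ht) _ _), ← mu_eq,
      ← mu_eq, mu_succ_add (hw t ht)]
  · filter_upwards [Metric.ball_mem_nhds t hδ] with s hs
    exact (integrable_mu (hw s (hb hs)) i j).aestronglyMeasurable
  · simp only [mul_add]
    exact ((integrable_mu (hw t ht) _ _).add (integrable_mu (hw t ht) _ _)).aestronglyMeasurable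
  · filter_upwards [ae_prod_pos] with p hp s hs
    obtain ⟨h1, h2⟩ := hp
    rw [Metric.mem_ball, Real.dist_eq, abs_lt] at hs
    have hsδ : s ≤ t + δ := by linarith
    have hn := fun k (x : ℝ) (hx : 0 < x) => wt_nonneg hρ k s hx
    have hm := fun k (x : ℝ) (hx : 0 < x) => wt_mono hρ k hsδ hx
    have h3 : ‖(p.1 - p.2) / (p.1 + p.2)‖ ≤ 1 := by
      rw [Real.norm_eq_abs, abs_div, abs_of_pos (add_pos h1 h2), div_le_one (add_pos h1 h2),
        abs_le]
      constructor <;> linarith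
    rw [norm_mul, Real.norm_of_nonneg (r := _ + _) (add_nonneg
      (mul_nonneg (hn _ _ h1) (hn _ _ h2)) (mul_nonneg (hn _ _ h1) (hn _ _ h2)))]
    refine (mul_le_of_le_one_left (add_nonneg
      (mul_nonneg (hn _ _ h1) (hn _ _ h2)) (mul_nonneg (hn _ _ h1) (hn _ _ h2))) h3).trans ?_
    exact add_le_add
      (mul_le_mul (hm _ _ h1) (hm _ _ h2) (hn _ _ h2) ((hn _ _ h1).trans (hm _ _ h1)))
      (mul_le_mul (hm _ _ h1) (hm _ _ h2) (hn _ _ h2) ((hn _ _ h1).trans (hm _ _ h1)))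
  · exact (integrable_wt_prod (hw _ hδI) _ _).add (integrable_wt_prod (hw _ hδI) _ _)
  · exact Filter.Eventually.of_forall fun p s _ =>
      ((hasDerivAt_wt i s p.1).mul (hasDerivAt_wt j s p.2)).const_mul _

theorem differentiableAt_entry (ht : t ∈ I) (a b : Label) :
    DifferentiableAt ℝ (fun s => entry ρ s a b) t := by
  cases a <;> cases b <;> simp only [entry]
  · exact differentiableAt_const _
  · exact (hasDerivAt_beta hI hρ hw ht _).differentiableAt
  · exact (hasDerivAt_beta hI hρ hw ht _).differentiableAt.neg
  · exact (hasDerivAt_mu hI hρ hw ht _ _).differentiableAt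

end Derivatives

end Moments

end BToda

namespace BToda

/-! ### Algebraic consequences of orthogonality at one time -/

section OrthData

/-- `h_n` for even `n` and `0` for odd `n`. -/
def evenPart (h : ℕ → ℝ) (n : ℕ) : ℝ := if Even n then h n else 0

theorem evenPart_even (h : ℕ → ℝ) {n : ℕ} (hn : Even n) : evenPart h n = h n := if_pos hn

theorem evenPart_odd (h : ℕ → ℝ) {n : ℕ} (hn : ¬ Even n) : evenPart h n = 0 := if_neg hn

theorem evenPart_mul_succ (h : ℕ → ℝ) (n : ℕ) : evenPart h n * evenPart h (n + 1) = 0 := by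
  by_cases hn : Even n
  · rw [evenPart_odd h (n := n + 1) (by simpa [Nat.even_add_one] using hn), mul_zero]
  · rw [evenPart_odd h hn, zero_mul]

/-- The values at one time of the moment functional `β`, of the form `B(p, q) = ⟨p, q⟩ + β(p) β(q)`,
of the partial-skew-orthogonal polynomials `P`, of `h_n = τ_{n+1} / τ_n` and of their
derivatives `P'`, `h'` in time. -/
structure OrthData (β : ℝ[X] →ₗ[ℝ] ℝ) (B : ℝ[X] →ₗ[ℝ] ℝ[X] →ₗ[ℝ] ℝ) (P P' : ℕ → ℝ[X])
    (h h' : ℕ → ℝ) : Prop where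
  shift : ∀ p q, B (X * p) q + B p (X * q) = 2 * β (X * p) * β q
  symm : ∀ p q, B p q + B q p = 2 * β p * β q
  nondeg : ∀ n q, natDegree q ≤ n → (∀ p, natDegree p ≤ n → B q p = 0) → q = 0
  ne_zero : ∀ n, h n ≠ 0
  natDegree_le : ∀ n, (P n).natDegree ≤ n
  coeff_self : ∀ n, (P n).coeff n = 1
  orth : ∀ n q, natDegree q ≤ n → B (P n) q = (-1) ^ n * h n * β q
  moment : ∀ n, β (P n) = evenPart h n
  deriv_zero : P' 0 = 0
  natDegree_deriv_le : ∀ n, (P' (n + 1)).natDegree ≤ n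
  -- The time derivative of `orth` for fixed `q`, where B itself contributes 2 β(X P_n) β(q).
  deriv_orth : ∀ n q, natDegree q ≤ n → B (P' n) q =
    -2 * β (X * P n) * β q + (-1) ^ n * h' n * β q + (-1) ^ n * h n * β (X * q)
  deriv_moment : ∀ n, β (P' n) + β (X * P n) = evenPart h' n

namespace OrthData

variable {β : ℝ[X] →ₗ[ℝ] ℝ} {B : ℝ[X] →ₗ[ℝ] ℝ[X] →ₗ[ℝ] ℝ} {P P' : ℕ → ℝ[X]} {h h' : ℕ → ℝ}

theorem sq_sign (n : ℕ) : ((-1 : ℝ) ^ n) * (-1) ^ n = 1 := by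
  rw [← mul_pow]; norm_num

/-- By nondegeneracy, representing a multiple of β determines a polynomial of degree at most n, and
`P n` represents such a multiple with nonzero factor. -/
theorem eq_smul_of_form_eq (H : OrthData β B P P' h h') {n : ℕ} {Q : ℝ[X]} {γ : ℝ}
    (hQ : Q.natDegree ≤ n) (hB : ∀ q, natDegree q ≤ n → B Q q = γ * β q) :
    Q = ((-1) ^ n * γ / h n) • P n := by
  rw [← sub_eq_zero]
  refine H.nondeg n _ ?_ fun p hp => ?_
  · exact (natDegree_sub_le _ _).trans (max_le hQ ((natDegree_smul_le _ _).trans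
      (H.natDegree_le n)))
  · rw [map_sub, map_smul, LinearMap.sub_apply, LinearMap.smul_apply, hB p hp, H.orth n p hp,
      smul_eq_mul]
    have := H.ne_zero n
    have := sq_sign n
    field_simp
    linear_combination (-γ * β p) * this

theorem natDegree_sub_le_of_coeff (H : OrthData β B P P' h h') {n : ℕ} {Q : ℝ[X]}
    (hQ : Q.natDegree ≤ n + 1) :
    (Q - Q.coeff (n + 1) • P (n + 1)).natDegree ≤ n := by
  rw [natDegree_le_iff_coeff_eq_zero]
  intro k hk
  rw [coeff_sub, coeff_smul, smul_eq_mul]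
  rcases Nat.eq_or_lt_of_le (Nat.succ_le_of_lt hk) with hk' | hk'
  · subst hk'
    rw [Nat.succ_eq_add_one, H.coeff_self]
    ring
  · rw [coeff_eq_zero_of_natDegree_lt (hQ.trans_lt hk'),
      coeff_eq_zero_of_natDegree_lt ((H.natDegree_le _).trans_lt hk')]
    ring

/-- The ratio h_{n+1}/h_n cancels the two β(Xq) terms in the differentiated orthogonality relations,
which makes the combination a multiple of `P n`. The factor still contains R = β(X(P_{n+1} + u
P_n)); applying β and comparing with `deriv_moment` determines R in either parity. -/
theorem deriv_combination (H : OrthData β B P P' h h') (n : ℕ) :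
    P' (n + 1) + (h (n + 1) / h n) • P' n =
      ((h' (n + 1) + h (n + 1) / h n * h' n) / h n) • P n ∧
    β (X * (P (n + 1) + (h (n + 1) / h n) • P n)) = (-1) ^ (n + 1) * h' (n + 1) := by
  set u := h (n + 1) / h n with hu
  have hn := H.ne_zero n
  have huh : u * h n = h (n + 1) := by rw [hu]; field_simp
  have hdeg : (P' n).natDegree ≤ n := by
    cases n with
    | zero => rw [H.deriv_zero]; simp
    | succ n => exact (H.natDegree_deriv_le n).trans (Nat.le_succ n)
  set R := β (X * (P (n + 1) + u • P n)) with hR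
  have hR' : R = β (X * P (n + 1)) + u * β (X * P n) := by
    rw [hR, mul_add, mul_smul_comm, map_add, map_smul, smul_eq_mul]
  have hQ := H.eq_smul_of_form_eq (n := n) (Q := P' (n + 1) + u • P' n)
    (γ := -2 * R + (-1) ^ (n + 1) * h' (n + 1) + u * ((-1) ^ n * h' n))
    ((natDegree_add_le _ _).trans (max_le (H.natDegree_deriv_le n)
      ((natDegree_smul_le _ _).trans hdeg))) (fun q hq => by
      rw [map_add, map_smul, LinearMap.add_apply, LinearMap.smul_apply, smul_eq_mul,
        H.deriv_orth _ q (hq.trans (Nat.le_succ n)), H.deriv_orth n q hq, hR', pow_succ]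
      linear_combination ((-1) ^ n * β (X * q)) * huh)
  have hβ := congrArg β hQ
  have d1 := H.deriv_moment (n + 1)
  have d0 := H.deriv_moment n
  rw [map_add, map_smul, map_smul, H.moment n, smul_eq_mul, smul_eq_mul] at hβ
  have hkey : R = (-1) ^ (n + 1) * h' (n + 1) := by
    rcases Nat.even_or_odd n with he | ho
    · have he' : ¬ Even (n + 1) := by simpa [Nat.even_add_one] using he
      rw [evenPart_odd _ he'] at d1
      rw [evenPart_even _ he] at d0
      rw [evenPart_even _ he, he.neg_one_pow, pow_succ, he.neg_one_pow] at hβ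
      rw [pow_succ, he.neg_one_pow]
      field_simp at hβ
      linear_combination hβ - d1 - u * d0 - hR'
    · have ho' : ¬ Even n := by simpa using ho
      have he' : Even (n + 1) := by simpa [Nat.even_add_one] using ho'
      rw [evenPart_even _ he'] at d1
      rw [evenPart_odd _ ho'] at d0
      rw [evenPart_odd _ ho', mul_zero] at hβ
      rw [he'.neg_one_pow]
      linear_combination d1 + u * d0 + hR' - hβ
  refine ⟨?_, hkey⟩
  rw [hQ, hkey]
  congr 1
  have := sq_sign n
  rw [pow_succ]
  congr 1
  linear_combination (h' (n + 1) + u * h' n) * this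

/-- The second argument is one degree too high for `orth`; the symmetry relation reduces to
B(P_{n+1}, P_n). -/
theorem form_succ (H : OrthData β B P P' h h') (n : ℕ) :
    B (P n) (P (n + 1)) = (-1) ^ n * h (n + 1) * evenPart h n := by
  have h1 := H.symm (P n) (P (n + 1))
  have h2 := H.orth (n + 1) (P n) ((H.natDegree_le n).trans (Nat.le_succ n))
  rw [H.moment, H.moment] at h1
  rw [H.moment, pow_succ] at h2
  linear_combination h1 - h2 + 2 * evenPart_mul_succ h n

/-- The combination is B-orthogonal to X q, so the shift identity leaves only its rank-one side. -/
theorem form_shift_of_natDegree_le (H : OrthData β B P P' h h') {n : ℕ} {q : ℝ[X]}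
    (hq : (X * q).natDegree ≤ n) :
    B (X * (P (n + 1) + (h (n + 1) / h n) • P n)) q =
      2 * ((-1) ^ (n + 1) * h' (n + 1)) * β q := by
  have hn := H.ne_zero n
  have h1 := H.shift (P (n + 1) + (h (n + 1) / h n) • P n) q
  rw [(H.deriv_combination n).2] at h1
  have h2 : B (P (n + 1) + (h (n + 1) / h n) • P n) (X * q) = 0 := by
    rw [map_add, map_smul, LinearMap.add_apply, LinearMap.smul_apply, smul_eq_mul,
      H.orth _ _ (hq.trans (Nat.le_succ n)), H.orth _ _ hq, pow_succ]
    field_simp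
    ring
  linear_combination h1 - h2

/-- The borderline case: X P_n has degree n + 1, but modulo degree n it equals P_{n+1}, whose
pairing is known from `form_succ`. -/
theorem form_shift_self (H : OrthData β B P P' h h') (n : ℕ) :
    B (X * (P (n + 1) + (h (n + 1) / h n) • P n)) (P n) =
      2 * ((-1) ^ (n + 1) * h' (n + 1)) * evenPart h n -
      (-1) ^ (n + 1) * h (n + 1) * (evenPart h (n + 1) - h (n + 1) / h n * evenPart h n) := by
  have hn := H.ne_zero n
  have h1 := H.shift (P (n + 1) + (h (n + 1) / h n) • P n) (P n)
  rw [(H.deriv_combination n).2, H.moment] at h1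
  have hd : (X * P n - P (n + 1)).natDegree ≤ n := by
    rw [natDegree_le_iff_coeff_eq_zero]
    intro k hk
    obtain ⟨k, rfl⟩ : ∃ l, k = l + 1 := ⟨k - 1, by omega⟩
    rw [coeff_sub, coeff_X_mul]
    rcases Nat.eq_or_lt_of_le (Nat.le_of_lt_succ hk) with rfl | hk'
    · rw [H.coeff_self, H.coeff_self, sub_self]
    · rw [coeff_eq_zero_of_natDegree_lt ((H.natDegree_le _).trans_lt hk'),
        coeff_eq_zero_of_natDegree_lt ((H.natDegree_le _).trans_lt (Nat.succ_lt_succ hk')),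
        sub_self]
  have h2 : B (P (n + 1) + (h (n + 1) / h n) • P n) (X * P n - P (n + 1)) = 0 := by
    rw [map_add, map_smul, LinearMap.add_apply, LinearMap.smul_apply, smul_eq_mul,
      H.orth _ _ (hd.trans (Nat.le_succ n)), H.orth _ _ hd, pow_succ]
    field_simp
    ring
  have h3 : B (P (n + 1) + (h (n + 1) / h n) • P n) (P (n + 1)) =
      (-1) ^ (n + 1) * h (n + 1) * (evenPart h (n + 1) - h (n + 1) / h n * evenPart h n) := by
    rw [map_add, map_smul, LinearMap.add_apply, LinearMap.smul_apply, smul_eq_mul,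
      H.orth _ _ (H.natDegree_le _), H.form_succ, H.moment, pow_succ]
    ring
  rw [map_sub] at h2
  linear_combination h1 - h2 - h3

theorem natDegree_shift_sub_le (H : OrthData β B P P' h h') (n : ℕ) (c : ℝ) :
    (X * (P (n + 1) + c • P n) - P (n + 2)).natDegree ≤ n + 1 := by
  rw [natDegree_le_iff_coeff_eq_zero]
  intro k hk
  obtain ⟨k, rfl⟩ : ∃ l, k = l + 1 := ⟨k - 1, by omega⟩
  rw [coeff_sub, coeff_X_mul, coeff_add, coeff_smul,
    coeff_eq_zero_of_natDegree_lt ((H.natDegree_le n).trans_lt (by omega : n < k))]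
  rcases Nat.eq_or_lt_of_le (Nat.le_of_lt_succ hk) with h1 | h1
  · rw [← h1, H.coeff_self, H.coeff_self]
    simp
  · rw [coeff_eq_zero_of_natDegree_lt ((H.natDegree_le _).trans_lt h1),
      coeff_eq_zero_of_natDegree_lt ((H.natDegree_le (n + 2)).trans_lt (by omega))]
    simp

theorem exists_eq_smul_zero (H : OrthData β B P P' h h') {Q : ℝ[X]} (hQ : Q.natDegree ≤ 0) :
    ∃ c : ℝ, Q = c • P 0 := by
  have hP0 : P 0 = 1 := by
    have := eq_C_of_natDegree_le_zero (H.natDegree_le 0)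
    rw [this, H.coeff_self, C_1]
  refine ⟨Q.coeff 0, ?_⟩
  conv_lhs => rw [eq_C_of_natDegree_le_zero hQ]
  rw [hP0, smul_eq_C_mul, mul_one]

theorem recurrence_zero (H : OrthData β B P P' h h') :
    X * P 0 = P 1 + (h' 0 / h 0) • P 0 := by
  have h0 := H.ne_zero 0
  have hd : (X * P 0 - P 1).natDegree ≤ 0 := by
    rw [natDegree_le_iff_coeff_eq_zero]
    intro k hk
    obtain ⟨k, rfl⟩ : ∃ l, k = l + 1 := ⟨k - 1, by omega⟩
    rw [coeff_sub, coeff_X_mul]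
    rcases k.eq_zero_or_pos with rfl | hk
    · rw [H.coeff_self, H.coeff_self, sub_self]
    · rw [coeff_eq_zero_of_natDegree_lt ((H.natDegree_le _).trans_lt hk),
        coeff_eq_zero_of_natDegree_lt ((H.natDegree_le 1).trans_lt (by omega)), sub_self]
  obtain ⟨A, hA⟩ := H.exists_eq_smul_zero hd
  have h1 := congrArg β hA
  have h2 := H.deriv_moment 0
  rw [H.deriv_zero, map_zero] at h2
  rw [map_sub, map_smul, H.moment, H.moment, smul_eq_mul] at h1
  simp only [evenPart, Nat.not_even_one, Even.zero, if_true, if_false] at h1 h2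
  rw [← sub_eq_iff_eq_add', hA]
  congr 1
  field_simp
  linarith

/-- Two unknown coefficients, found by applying β and by pairing with P_0. -/
theorem recurrence_one (H : OrthData β B P P' h h') :
    X * (P 1 + (h 1 / h 0) • P 0) = P 2 + (h' 1 / h 1 + h 1 / h 0) • P 1 -
      (h 1 / h 0 * (h' 1 / h 1 + h 2 / h 1)) • P 0 := by
  have h0 := H.ne_zero 0
  have h1 := H.ne_zero 1
  set w := P 1 + (h 1 / h 0) • P 0 with hw
  have hQd : (X * w - P 2).natDegree ≤ 0 + 1 := H.natDegree_shift_sub_le 0 _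
  set A := (X * w - P 2).coeff (0 + 1) with hA
  have hS := H.natDegree_sub_le_of_coeff hQd
  obtain ⟨α, hα⟩ := H.exists_eq_smul_zero hS
  have hR : X * w = P 2 + A • P 1 + α • P 0 := by
    rw [← hα]; abel
  have e1 := congrArg β hR
  have e2 := congrArg (fun p => B p (P 0)) hR
  simp only [map_add, map_smul, LinearMap.add_apply, LinearMap.smul_apply, smul_eq_mul] at e1 e2
  have k1 : B (X * w) (P 0) = _ := H.form_shift_self 0
  have k2 : β (X * w) = _ := (H.deriv_combination 0).2
  rw [k2, H.moment, H.moment, H.moment] at e1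
  rw [k1, H.orth 2 _ ((H.natDegree_le 0).trans (by norm_num)),
    H.orth 1 _ ((H.natDegree_le 0).trans (by norm_num)), H.orth 0 _ (H.natDegree_le 0),
    H.moment] at e2
  simp only [evenPart, Nat.not_even_one, Even.zero, even_two, if_true, if_false, zero_add] at e1 e2
  have hAv : A = h' 1 / h 1 + h 1 / h 0 := by
    field_simp
    field_simp at e2
    linear_combination e2 - h 0 * e1
  have hαv : α = -(h 1 / h 0 * (h' 1 / h 1 + h 2 / h 1)) := by
    field_simp
    linear_combination -e1
  rw [hR, hAv, hαv, neg_smul, sub_eq_add_neg]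

theorem recurrence_add_two (H : OrthData β B P P' h h') (n : ℕ) :
    X * (P (n + 2) + (h (n + 2) / h (n + 1)) • P (n + 1)) =
      P (n + 3) + (h' (n + 2) / h (n + 2) + h (n + 2) / h (n + 1)) • P (n + 2) -
      (h (n + 2) / h (n + 1) * (h' (n + 2) / h (n + 2) + h (n + 3) / h (n + 2))) • P (n + 1) -
      ((h (n + 2) / h (n + 1)) ^ 2 * (h (n + 1) / h n)) • P n := by
  have h0 := H.ne_zero n
  have h1 := H.ne_zero (n + 1)
  have h2 := H.ne_zero (n + 2)
  set w := P (n + 2) + (h (n + 2) / h (n + 1)) • P (n + 1) with hw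
  have hQd : (X * w - P (n + 3)).natDegree ≤ n + 1 + 1 := H.natDegree_shift_sub_le (n + 1) _
  set A := (X * w - P (n + 3)).coeff (n + 1 + 1) with hA
  have hS := H.natDegree_sub_le_of_coeff hQd
  set Q := X * w - P (n + 3) - A • P (n + 1 + 1) with hQ
  set α := Q.coeff (n + 1) with hα
  have hT := H.natDegree_sub_le_of_coeff hS
  -- The factor of β(q) in the pairing of the remainder with q of degree at most n. It makes the
  -- remainder `δ • P n`, with `γ` giving one equation among `A`, `α`, `δ`.
  set γ := 2 * ((-1) ^ (n + 2) * h' (n + 2)) - (-1) ^ (n + 3) * h (n + 3) -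
    A * ((-1) ^ (n + 2) * h (n + 2)) - α * ((-1) ^ (n + 1) * h (n + 1)) with hγ
  have hδ := H.eq_smul_of_form_eq (γ := γ) hT (fun q hq => by
    have hX : (X * q).natDegree ≤ n + 1 := natDegree_mul_le.trans (by rw [natDegree_X]; omega)
    have := H.form_shift_of_natDegree_le hX
    rw [map_sub, map_smul, LinearMap.sub_apply, LinearMap.smul_apply, smul_eq_mul, hQ, map_sub,
      map_smul, LinearMap.sub_apply, LinearMap.smul_apply, smul_eq_mul, map_sub,
      LinearMap.sub_apply, this, H.orth (n + 3) q (by omega), H.orth (n + 1 + 1) q (by omega),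
      H.orth (n + 1) q (by omega), hγ]
    ring)
  set δ := (-1) ^ n * γ / h n with hδ'
  have hR : X * w = P (n + 3) + A • P (n + 2) + α • P (n + 1) + δ • P n := by
    rw [← hδ, hQ]; abel
  have hγδ : γ = (-1) ^ n * h n * δ := by
    rw [hδ']
    field_simp
    linear_combination (-γ) * sq_sign n
  clear_value δ
  -- Two more equations, from β and from pairing with P_{n+1}. Vanishing odd moments make the system
  -- triangular: for even n it yields δ, A, α in this order, for odd n α, A, δ.
  have e1 := congrArg β hR
  have e2 := congrArg (fun p => B p (P (n + 1))) hR
  simp only [map_add, map_smul, LinearMap.add_apply, LinearMap.smul_apply, smul_eq_mul] at e1 e2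
  have k1 : B (X * w) (P (n + 1)) = _ := H.form_shift_self (n + 1)
  have k2 : β (X * w) = _ := (H.deriv_combination (n + 1)).2
  have hd := H.natDegree_le (n + 1)
  rw [k2, H.moment, H.moment, H.moment, H.moment] at e1
  rw [k1, H.orth (n + 3) _ (hd.trans (by omega)), H.orth (n + 2) _ (hd.trans (by omega)),
    H.orth (n + 1) _ hd, H.moment, H.form_succ] at e2
  simp only [show n + 1 + 1 = n + 2 from rfl] at e1 e2
  have hvals : δ = -((h (n + 2) / h (n + 1)) ^ 2 * (h (n + 1) / h n)) ∧
      A = h' (n + 2) / h (n + 2) + h (n + 2) / h (n + 1) ∧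
      α = -(h (n + 2) / h (n + 1) * (h' (n + 2) / h (n + 2) + h (n + 3) / h (n + 2))) := by
    rw [hγδ] at hγ
    by_cases hn : Even n
    · have p1 : ¬ Even (n + 1) := by simpa [Nat.even_add_one] using hn
      have p2 : Even (n + 2) := by simpa [Nat.even_add_one] using hn
      have p3 : ¬ Even (n + 3) := by simpa [Nat.even_add_one] using hn
      rw [evenPart_odd _ p3, evenPart_even _ p2, evenPart_odd _ p1, evenPart_even _ hn] at e1
      rw [evenPart_even _ p2, evenPart_odd _ p1, evenPart_even _ hn] at e2
      simp only [pow_add, hn.neg_one_pow] at e1 e2 hγ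
      norm_num at e1 e2 hγ
      have d : δ = -((h (n + 2) / h (n + 1)) ^ 2 * (h (n + 1) / h n)) := by
        field_simp
        linear_combination -e2
      have a : A = h' (n + 2) / h (n + 2) + h (n + 2) / h (n + 1) := by
        rw [d] at e1
        field_simp
        field_simp at e1
        linear_combination -e1
      refine ⟨d, a, ?_⟩
      rw [d, a] at hγ
      field_simp
      field_simp at hγ
      refine mul_left_cancel₀ h1 ?_
      linear_combination -hγ
    · have p1 : Even (n + 1) := by simpa [Nat.even_add_one] using hn
      have p2 : ¬ Even (n + 2) := by simpa [Nat.even_add_one] using hn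
      have p3 : Even (n + 3) := by simpa [Nat.even_add_one] using hn
      have ho : Odd n := by simpa using hn
      rw [evenPart_even _ p3, evenPart_odd _ p2, evenPart_even _ p1, evenPart_odd _ hn] at e1
      rw [evenPart_odd _ p2, evenPart_even _ p1, evenPart_odd _ hn] at e2
      simp only [pow_add, ho.neg_one_pow] at e1 e2 hγ
      norm_num at e1 e2 hγ
      have a : α = -(h (n + 2) / h (n + 1) * (h' (n + 2) / h (n + 2) + h (n + 3) / h (n + 2))) := by
        field_simp
        linear_combination -e1
      have hA' : A = h' (n + 2) / h (n + 2) + h (n + 2) / h (n + 1) := by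
        rw [a] at e2
        field_simp
        field_simp at e2
        linear_combination e2
      refine ⟨?_, hA', a⟩
      rw [hA', a] at hγ
      field_simp
      field_simp at hγ
      linear_combination -hγ
  rw [hR, hvals.1, hvals.2.1, hvals.2.2, neg_smul, neg_smul]
  abel

end OrthData

end OrthData

end BToda

namespace BToda

/-! ### Bilinear forms given by a Gram matrix -/

section Form

theorem lin_congr {a b : ℕ → ℝ} {n : ℕ} (hab : ∀ j ≤ n, a j = b j) {q : ℝ[X]}
    (hq : q.natDegree ≤ n) : lin a q = lin b q := by
  rw [lin_eq_sum _ (Nat.lt_succ_of_le hq), lin_eq_sum _ (Nat.lt_succ_of_le hq)]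
  exact Finset.sum_congr rfl fun j hj => by rw [hab j (Finset.mem_range_succ_iff.1 hj)]

theorem lin_X_mul (a : ℕ → ℝ) (p : ℝ[X]) : lin a (X * p) = lin (fun i => a (i + 1)) p := by
  have h : (X * p).natDegree < p.natDegree + 1 + 1 := by
    have := natDegree_mul_le (p := X) (q := p)
    rw [natDegree_X] at this
    omega
  rw [lin_eq_sum _ h, Finset.sum_range_succ', lin_eq_sum _ (Nat.lt_succ_self _)]
  simp [coeff_X_mul]

theorem lin_lin_comm (M : ℕ → ℕ → ℝ) (p q : ℝ[X]) :
    lin (fun j => lin (fun i => M i j) p) q = lin (fun i => lin (fun j => M i j) q) p := by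
  simp only [lin_eq_sum _ (Nat.lt_succ_self _), Finset.mul_sum]
  rw [Finset.sum_comm]
  exact Finset.sum_congr rfl fun i _ => Finset.sum_congr rfl fun j _ => by ring

/-- The bilinear form on polynomials with Gram matrix `M`. -/
noncomputable def gramForm (M : ℕ → ℕ → ℝ) : ℝ[X] →ₗ[ℝ] ℝ[X] →ₗ[ℝ] ℝ :=
  LinearMap.mk₂ ℝ (fun p q => lin (fun j => lin (fun i => M i j) p) q)
    (fun p p' q => by simp only [map_add, lin_add])
    (fun c p q => by simp only [map_smul, smul_eq_mul, mul_comm c, lin_mul_const])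
    (fun p q q' => by simp only [map_add])
    (fun c p q => by simp only [map_smul])

theorem gramForm_apply (M : ℕ → ℕ → ℝ) (p q : ℝ[X]) :
    gramForm M p q = lin (fun j => lin (fun i => M i j) p) q := rfl

theorem lin_lin_mul (a b : ℕ → ℝ) (p q : ℝ[X]) :
    lin (fun j => lin (fun i => a i * b j) p) q = lin a p * lin b q := by
  simp only [lin_mul_const]
  simp only [mul_comm (lin a p), lin_mul_const]

end Form

/-! ### Coefficientwise time derivatives -/

section PolynomialDerivative

/-- The polynomial of degree at most `n` whose coefficients are the derivatives of those of `P`. -/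
noncomputable def polyDeriv (P : ℝ → ℝ[X]) (n : ℕ) (t : ℝ) : ℝ[X] :=
  ∑ k ∈ Finset.range (n + 1), C (deriv (fun s => (P s).coeff k) t) * X ^ k

variable {P : ℝ → ℝ[X]} {n : ℕ} {t : ℝ}

theorem coeff_polyDeriv (hP : ∀ s, (P s).natDegree ≤ n) (k : ℕ) :
    (polyDeriv P n t).coeff k = deriv (fun s => (P s).coeff k) t := by
  rw [polyDeriv, finsetSum_coeff]
  simp only [coeff_C_mul_X_pow]
  rw [Finset.sum_ite_eq]
  split_ifs with h
  · rfl
  · rw [Finset.mem_range, not_lt] at h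
    have : (fun s => (P s).coeff k) = fun _ => 0 :=
      funext fun s => coeff_eq_zero_of_natDegree_lt ((hP s).trans_lt h)
    rw [this, deriv_const]

theorem natDegree_polyDeriv_le (P : ℝ → ℝ[X]) (n : ℕ) (t : ℝ) :
    (polyDeriv P n t).natDegree ≤ n :=
  natDegree_sum_le_of_forall_le _ _ fun _ hk =>
    (natDegree_C_mul_X_pow_le _ _).trans (Finset.mem_range_succ_iff.1 hk)

theorem hasDerivAt_lin (hP : ∀ s, (P s).natDegree ≤ n)
    (hd : ∀ k, DifferentiableAt ℝ (fun s => (P s).coeff k) t) {a : ℕ → ℝ → ℝ} {a' : ℕ → ℝ}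
    (ha : ∀ i, HasDerivAt (a i) (a' i) t) :
    HasDerivAt (fun s => lin (fun i => a i s) (P s))
      (lin (fun i => a i t) (polyDeriv P n t) + lin a' (P t)) t := by
  have e : (fun s => lin (fun i => a i s) (P s)) =
      fun s => ∑ i ∈ Finset.range (n + 1), (P s).coeff i * a i s :=
    funext fun s => lin_eq_sum _ (Nat.lt_succ_of_le (hP s))
  rw [e, lin_eq_sum _ (Nat.lt_succ_of_le (natDegree_polyDeriv_le P n t)),
    lin_eq_sum _ (Nat.lt_succ_of_le (hP t)), ← Finset.sum_add_distrib]
  refine HasDerivAt.fun_sum fun i _ => ?_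
  rw [coeff_polyDeriv hP]
  exact (hd i).hasDerivAt.mul (ha i)

theorem lin_pow (z : ℝ) (p : ℝ[X]) : lin (fun i => z ^ i) p = p.eval z := by
  have := lin_pow_mul z 1 p
  simpa using this

theorem hasDerivAt_eval (hP : ∀ s, (P s).natDegree ≤ n)
    (hd : ∀ k, DifferentiableAt ℝ (fun s => (P s).coeff k) t) (z : ℝ) :
    HasDerivAt (fun s => (P s).eval z) ((polyDeriv P n t).eval z) t := by
  have h := hasDerivAt_lin hP hd (a := fun i _ => z ^ i) (a' := fun _ => 0)
    fun i => hasDerivAt_const _ _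
  simp only [lin_pow] at h
  convert h using 1
  rw [lin_eq_sum _ (Nat.lt_succ_self _)]
  simp

end PolynomialDerivative

/-! ### The polynomials P_n as orthogonality data -/

section Psop

variable {ρ : ℝ → ℝ} {I : Set ℝ} {t : ℝ}

/-- The Gram matrix of the form `⟨p, q⟩ + β(p) β(q)`. -/
noncomputable def gram (ρ : ℝ → ℝ) (t : ℝ) (i j : ℕ) : ℝ :=
  mu ρ t i j + beta ρ t i * beta ρ t j

theorem lin_gram_wave (n j : ℕ) (hj : j ≤ n) :
    lin (fun i => gram ρ t i j) (wave ρ n t) = (-1) ^ n * tau ρ (n + 1) t * beta ρ t j := by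
  simp only [gram]
  rw [lin_add, lin_mul_const, lin_mu_wave entry_skew n j hj, lin_beta_wave entry_skew]
  split_ifs with hn
  · rw [hn.neg_one_pow]; ring
  · rw [(Nat.not_even_iff_odd.1 hn).neg_one_pow]; ring

theorem natDegree_psop_le (n : ℕ) : (psop ρ n t).natDegree ≤ n :=
  (natDegree_C_mul_le _ _).trans (natDegree_wave_le n)

/-- The norming constants `h_n = τ_{n+1} / τ_n`. -/
noncomputable def normConst (ρ : ℝ → ℝ) (n : ℕ) (t : ℝ) : ℝ := tau ρ (n + 1) t / tau ρ n t

theorem lin_psop (a : ℕ → ℝ) (n : ℕ) :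
    lin a (psop ρ n t) = (tau ρ n t)⁻¹ * lin a (wave ρ n t) := by
  rw [psop_eq, ← smul_eq_C_mul, map_smul, smul_eq_mul]

/-- No nonvanishing of τ_n is needed: where it vanishes, both sides are 0 by the convention for
inverses. The identity can therefore be differentiated as an equality of functions of time. -/
theorem lin_gram_psop (n j : ℕ) (hj : j ≤ n) :
    lin (fun i => gram ρ t i j) (psop ρ n t) = (-1) ^ n * normConst ρ n t * beta ρ t j := by
  rw [lin_psop, lin_gram_wave n j hj, normConst]
  ring

theorem lin_beta_psop (n : ℕ) :
    lin (beta ρ t) (psop ρ n t) = evenPart (fun n => normConst ρ n t) n := by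
  rw [lin_psop, lin_beta_wave entry_skew, evenPart, normConst]
  split_ifs <;> ring

variable (hI : IsOpen I) (hρ : ∀ x, 0 < x → 0 ≤ ρ x) (hne : ¬ (∀ᵐ x ∂posVol, ρ x = 0))
  (hw : ∀ t ∈ I, ∀ i, Integrable (wt ρ t i) posVol) (ht : t ∈ I)

-- If τ_{n+1} vanished, the numerator of P_n would pair to zero with all degrees at most n, hence be
-- zero; but its leading coefficient is τ_n.
include hρ hne hw ht in
theorem tau_ne_zero (n : ℕ) : tau ρ n t ≠ 0 := by
  induction n with
  | zero => rw [tau_zero]; exact one_ne_zero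
  | succ n ih =>
    intro h
    refine ih ?_
    have h0 := form_nondegenerate (hw t ht) hρ hne (natDegree_wave_le (ρ := ρ) (t := t) n)
      fun j hj => by
        have := lin_gram_wave (ρ := ρ) (t := t) n j hj
        rwa [h, mul_zero, zero_mul] at this
    rw [← coeff_wave_self entry_skew, h0, coeff_zero]

include hρ hne hw ht in
theorem coeff_psop_self (n : ℕ) : (psop ρ n t).coeff n = 1 := by
  rw [psop_eq, coeff_C_mul, coeff_wave_self entry_skew,
    inv_mul_cancel₀ (tau_ne_zero hρ hne hw ht n)]

include hI hρ hne hw ht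

theorem differentiableAt_coeff_psop (n k : ℕ) :
    DifferentiableAt ℝ (fun s => (psop ρ n s).coeff k) t := by
  simp only [psop_eq, coeff_C_mul]
  exact ((differentiableAt_tau (differentiableAt_entry hI hρ hw ht) n).inv
    (tau_ne_zero hρ hne hw ht n)).mul
    (differentiableAt_coeff_wave (differentiableAt_entry hI hρ hw ht) n k)

theorem differentiableAt_normConst (n : ℕ) : DifferentiableAt ℝ (normConst ρ n) t :=
  (differentiableAt_tau (differentiableAt_entry hI hρ hw ht) (n + 1)).div
    (differentiableAt_tau (differentiableAt_entry hI hρ hw ht) n) (tau_ne_zero hρ hne hw ht n)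

omit hne in
theorem hasDerivAt_gram (i j : ℕ) : HasDerivAt (fun s => gram ρ s i j)
    (2 * beta ρ t (i + 1) * beta ρ t j) t := by
  refine ((hasDerivAt_mu hI hρ hw ht i j).add ((hasDerivAt_beta hI hρ hw ht i).mul
    (hasDerivAt_beta hI hρ hw ht j))).congr_deriv ?_
  ring

theorem orthData : OrthData (lin (beta ρ t)) (gramForm (gram ρ t)) (fun n => psop ρ n t)
    (fun n => polyDeriv (psop ρ n) n t) (fun n => normConst ρ n t)
    (fun n => deriv (normConst ρ n) t) where
  shift p q := by
    simp only [gramForm_apply, lin_X_mul]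
    rw [← lin_add]
    simp only [← lin_add]
    rw [mul_assoc, ← lin_lin_mul, mul_comm, ← lin_mul_const]
    congr 2
    ext j
    rw [← lin_mul_const]
    congr 2
    ext i
    have := mu_succ_add (hw t ht) i j
    simp only [gram]
    linear_combination this
  symm p q := by
    simp only [gramForm_apply]
    rw [lin_lin_comm _ q p, ← lin_add]
    simp only [← lin_add]
    rw [mul_assoc, ← lin_lin_mul, mul_comm, ← lin_mul_const]
    congr 2
    ext j
    rw [← lin_mul_const]
    congr 2
    ext i
    have := mu_skew (ρ := ρ) (t := t) i j
    simp only [gram]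
    linear_combination this
  nondeg n q hq h := by
    refine form_nondegenerate (hw t ht) hρ hne hq fun j hj => ?_
    have := h (X ^ j) (by rwa [natDegree_X_pow])
    rwa [gramForm_apply, lin_X_pow] at this
  ne_zero n := div_ne_zero (tau_ne_zero hρ hne hw ht _) (tau_ne_zero hρ hne hw ht _)
  natDegree_le n := natDegree_psop_le n
  coeff_self n := coeff_psop_self hρ hne hw ht n
  orth n q hq := by
    rw [gramForm_apply, lin_congr (fun j hj => (lin_gram_psop n j hj).trans (mul_comm _ _)) hq,
      lin_mul_const, mul_comm]
  moment n := lin_beta_psop n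
  deriv_zero := by
    ext k
    rw [coeff_polyDeriv fun s => natDegree_psop_le 0]
    rcases k.eq_zero_or_pos with rfl | hk
    · have : (fun s => (psop ρ 0 s).coeff 0) =ᶠ[nhds t] fun _ => 1 := by
        filter_upwards [hI.mem_nhds ht] with s hs
        exact coeff_psop_self hρ hne hw hs 0
      rw [this.deriv_eq, deriv_const, coeff_zero]
    · have : (fun s => (psop ρ 0 s).coeff k) = fun _ => 0 :=
        funext fun s => coeff_eq_zero_of_natDegree_lt ((natDegree_psop_le 0).trans_lt hk)
      rw [this, deriv_const, coeff_zero]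
  -- The leading coefficient is 1 throughout a neighbourhood of `t`, as `I` is open, so its
  -- derivative vanishes.
  natDegree_deriv_le n := by
    rw [natDegree_le_iff_coeff_eq_zero]
    intro k hk
    rw [coeff_polyDeriv fun s => natDegree_psop_le (n + 1)]
    rcases Nat.eq_or_lt_of_le (Nat.succ_le_of_lt hk) with rfl | hk
    · have : (fun s => (psop ρ (n + 1) s).coeff n.succ) =ᶠ[nhds t] fun _ => 1 := by
        filter_upwards [hI.mem_nhds ht] with s hs
        exact coeff_psop_self hρ hne hw hs _
      rw [this.deriv_eq, deriv_const]
    · have : (fun s => (psop ρ (n + 1) s).coeff k) = fun _ => 0 :=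
        funext fun s => coeff_eq_zero_of_natDegree_lt ((natDegree_psop_le _).trans_lt hk)
      rw [this, deriv_const]
  deriv_orth n q hq := by
    -- The pairing with X^j is differentiated in two ways, by the product rule and through its value
    -- in terms of h_n and β_j; derivatives are unique.
    have key : ∀ j ≤ n, lin (fun i => gram ρ t i j) (polyDeriv (psop ρ n) n t) =
        beta ρ t j * (-2 * lin (beta ρ t) (X * psop ρ n t) +
          (-1) ^ n * deriv (normConst ρ n) t) +
          beta ρ t (j + 1) * ((-1) ^ n * normConst ρ n t) := by
      intro j hj
      have h1 := hasDerivAt_lin (fun s => natDegree_psop_le n)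
        (differentiableAt_coeff_psop hI hρ hne hw ht n)
        (fun i => hasDerivAt_gram hI hρ hw ht i j)
      simp only [lin_gram_psop n j hj] at h1
      have h2 := ((differentiableAt_normConst hI hρ hne hw ht n).hasDerivAt.const_mul
        ((-1) ^ n)).mul (hasDerivAt_beta hI hρ hw ht j)
      have h3 := h1.unique h2
      rw [lin_mul_const] at h3
      simp only [mul_comm (2 : ℝ)] at h3
      rw [lin_mul_const, ← lin_X_mul] at h3
      linear_combination h3
    rw [gramForm_apply, lin_congr key hq, lin_add, lin_mul_const, lin_mul_const, ← lin_X_mul]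
    ring
  deriv_moment n := by
    have h1 := hasDerivAt_lin (fun s => natDegree_psop_le n)
      (differentiableAt_coeff_psop hI hρ hne hw ht n) (fun i => hasDerivAt_beta hI hρ hw ht i)
    have h2 : HasDerivAt (fun s => lin (fun i => beta ρ s i) (psop ρ n s))
        (evenPart (fun n => deriv (normConst ρ n) t) n) t := by
      have e : (fun s => lin (fun i => beta ρ s i) (psop ρ n s)) =
          fun s => evenPart (fun n => normConst ρ n s) n := funext fun s => lin_beta_psop n
      rw [e]
      unfold evenPart
      split_ifs
      · exact (differentiableAt_normConst hI hρ hne hw ht n).hasDerivAt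
      · exact hasDerivAt_const _ _
    rw [← h1.unique h2, lin_X_mul]

omit hI in
theorem u_succ (n : ℕ) : u ρ (n + 1) t = normConst ρ (n + 1) t / normConst ρ n t := by
  have h0 := tau_ne_zero hρ hne hw ht n
  have h1 := tau_ne_zero hρ hne hw ht (n + 1)
  simp only [u, prev, normConst]
  field_simp

theorem b_succ_sub (n : ℕ) :
    b ρ (n + 1) t - b ρ n t = deriv (normConst ρ n) t / normConst ρ n t := by
  have hd := differentiableAt_tau (differentiableAt_entry hI hρ hw ht)
  have h0 := tau_ne_zero hρ hne hw ht
  rw [← logDeriv_apply, b, b]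
  exact (logDeriv_div t (h0 _) (h0 _) (hd _) (hd _)).symm

end Psop

theorem u_zero (ρ : ℝ → ℝ) (t : ℝ) : u ρ 0 t = 0 := by simp [u, prev]

theorem b_zero (ρ : ℝ → ℝ) (t : ℝ) : b ρ 0 t = 0 := by
  have : tau ρ 0 = fun _ => 1 := funext fun s => tau_zero
  rw [b, this, logDeriv_apply, deriv_const, zero_div]

/-! ### Recurrence, evolution and lattice for the polynomials -/

section Evolution

variable {ρ : ℝ → ℝ} {I : Set ℝ} {t : ℝ}
variable (hI : IsOpen I) (hρ : ∀ x, 0 < x → 0 ≤ ρ x) (hne : ¬ (∀ᵐ x ∂posVol, ρ x = 0))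
  (hw : ∀ t ∈ I, ∀ i, Integrable (wt ρ t i) posVol) (ht : t ∈ I)

include hI hρ hne hw ht

theorem psop_recurrence (n : ℕ) :
    X * (psop ρ n t + C (u ρ n t) * prev (fun k => psop ρ k t) n) =
      psop ρ (n + 1) t + C (b ρ (n + 1) t - b ρ n t + u ρ n t) * psop ρ n t -
      C (u ρ n t * (b ρ (n + 1) t - b ρ n t + u ρ (n + 1) t)) * prev (fun k => psop ρ k t) n -
      C (u ρ n t ^ 2 * prev (fun k => u ρ k t) n) *
        prev (prev (fun k => psop ρ k t)) n := by
  have H := orthData hI hρ hne hw ht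
  have hu := u_succ hρ hne hw ht
  have hb := b_succ_sub hI hρ hne hw ht
  match n with
  | 0 =>
    have := H.recurrence_zero
    simp only [hb, u_zero, prev, ← smul_eq_C_mul]
    simpa using this
  | 1 =>
    have := H.recurrence_one
    simp only [hb, hu, prev, ← smul_eq_C_mul]
    simpa using this
  | n + 2 =>
    have := H.recurrence_add_two n
    simp only [hb, hu, prev, ← smul_eq_C_mul]
    exact this

theorem psop_deriv (n : ℕ) :
    polyDeriv (psop ρ (n + 1)) (n + 1) t + C (u ρ (n + 1) t) * polyDeriv (psop ρ n) n t =
      C (u ρ (n + 1) t * (b ρ (n + 2) t - b ρ n t)) * psop ρ n t := by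
  have H := orthData hI hρ hne hw ht
  have hu := u_succ hρ hne hw ht
  have hb := b_succ_sub hI hρ hne hw ht
  have h0 := H.ne_zero n
  have h1 := H.ne_zero (n + 1)
  have h := (H.deriv_combination n).1
  have e : b ρ (n + 2) t - b ρ n t = deriv (normConst ρ (n + 1)) t / normConst ρ (n + 1) t +
      deriv (normConst ρ n) t / normConst ρ n t := by
    rw [← hb, ← hb]; ring
  rw [e, hu, ← smul_eq_C_mul, ← smul_eq_C_mul]
  refine h.trans ?_
  congr 1
  field_simp

/-- The subleading coefficients in the recurrence express b_{n+2} - b_{n+1} as a difference of such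
coefficients; the sum telescopes from b_0 = 0. -/
theorem b_succ_eq_neg_coeff (n : ℕ) : b ρ (n + 1) t = -(psop ρ (n + 1) t).coeff n := by
  have hc := fun n => coeff_psop_self hρ hne hw ht n
  have hz : ∀ m k, m < k → (psop ρ m t).coeff k = 0 := fun m k h =>
    coeff_eq_zero_of_natDegree_lt ((natDegree_psop_le m).trans_lt h)
  induction n with
  | zero =>
    have h := congrArg (fun p => p.coeff 0) (psop_recurrence hI hρ hne hw ht 0)
    simp only [coeff_X_mul_zero, prev, coeff_sub, coeff_add, coeff_C_mul, coeff_zero, hc, b_zero,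
      u_zero] at h
    linear_combination -h
  | succ n ih =>
    have h := congrArg (fun p => p.coeff (n + 1)) (psop_recurrence hI hρ hne hw ht (n + 1))
    have h2 : (prev (prev fun k => psop ρ k t) (n + 1)).coeff (n + 1) = 0 := by
      cases n with
      | zero => simp [prev]
      | succ n => exact hz n _ (by omega)
    have h1 : prev (fun k => psop ρ k t) (n + 1) = psop ρ n t := rfl
    simp only [coeff_X_mul, h1, coeff_sub, coeff_add, coeff_C_mul, hc, hz n (n + 1) (by omega)] at h
    rw [h2] at h
    linear_combination ih - h

/-- The first equation is the quotient rule for u_{n+1}. The second is the coefficient of z^n in the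
evolution equation, where P_n' has no such term because P_n is monic. -/
theorem latticeAt_u_b : LatticeAt (u ρ) (b ρ) t := by
  intro n
  have hd := fun n => (differentiableAt_tau (differentiableAt_entry hI hρ hw ht) n).hasDerivAt
  have h0 := tau_ne_zero hρ hne hw ht
  constructor
  · refine (((hd (n + 2)).mul (hd n)).div ((hd (n + 1)).pow 2)
      (pow_ne_zero 2 (h0 (n + 1)))).congr_deriv ?_
    have h1 := h0 n
    have h2 := h0 (n + 1)
    have h3 := h0 (n + 2)
    simp only [u, b, prev, logDeriv_apply, Pi.mul_apply, Pi.pow_apply]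
    field_simp
    ring
  · have h1 := (differentiableAt_coeff_psop hI hρ hne hw ht (n + 1) n).hasDerivAt.neg
    have h2 : b ρ (n + 1) =ᶠ[nhds t] fun s => -(psop ρ (n + 1) s).coeff n := by
      filter_upwards [hI.mem_nhds ht] with s hs
      exact b_succ_eq_neg_coeff hI hρ hne hw hs n
    refine (h1.congr_of_eventuallyEq h2).congr_deriv ?_
    have h3 := congrArg (fun p => p.coeff n) (psop_deriv hI hρ hne hw ht n)
    have h4 : (polyDeriv (psop ρ n) n t).coeff n = 0 := by
      cases n with
      | zero =>
        have : polyDeriv (psop ρ 0) 0 t = 0 := (orthData hI hρ hne hw ht).deriv_zero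
        rw [this, coeff_zero]
      | succ n =>
        exact coeff_eq_zero_of_natDegree_lt
          (((orthData hI hρ hne hw ht).natDegree_deriv_le n).trans_lt (Nat.lt_succ_self n))
    simp only [coeff_add, coeff_C_mul, coeff_psop_self hρ hne hw ht, h4,
      coeff_polyDeriv fun s => natDegree_psop_le (ρ := ρ) (t := s) (n + 1)] at h3
    linear_combination -h3

end Evolution

end BToda

namespace BToda

/-! ### Entries of L, B and their commutator -/

section Matrices

theorem L1inv_zero_apply (u : ℕ → ℝ) (k : ℕ) : L1inv u 0 k = if k = 0 then 1 else 0 := by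
  rcases k.eq_zero_or_pos with rfl | hk
  · simp [L1inv]
  · simp [L1inv, hk.ne']

theorem L1inv_succ_apply (u : ℕ → ℝ) (n k : ℕ) :
    L1inv u (n + 1) k = (if k = n + 1 then 1 else 0) - u (n + 1) * L1inv u n k := by
  simp only [L1inv, Matrix.of_apply]
  rcases lt_trichotomy k (n + 1) with h | h | h
  · rw [if_pos h.le, if_neg h.ne, if_pos (Nat.lt_succ_iff.1 h),
      Finset.prod_Ioc_succ_top (Nat.lt_succ_iff.1 h)]
    ring
  · subst h
    simp
  · rw [if_neg (by omega), if_neg (by omega), if_neg (by omega)]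
    ring

theorem mul_L1inv_apply (u : ℕ → ℝ) (A : Matrix ℕ ℕ ℝ) {n N : ℕ} (h : n < N) (j : ℕ) :
    mul (L1inv u) A n j = ∑ k ∈ Finset.range N, L1inv u n k * A k j := by
  simp only [mul, Matrix.of_apply]
  refine finsum_eq_sum_of_support_subset _ fun k hk => ?_
  rw [Finset.coe_range, Set.mem_Iio]
  by_contra hk'
  exact hk (by simp [L1inv, show ¬ k ≤ n by omega])

theorem mul_L1inv_zero (u : ℕ → ℝ) (A : Matrix ℕ ℕ ℝ) (j : ℕ) : mul (L1inv u) A 0 j = A 0 j := by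
  rw [mul_L1inv_apply u A (Nat.lt_succ_self 0)]
  simp [L1inv_zero_apply]

/-- Row n + 1 of L_1 (L_1⁻¹ A) = A; it permits induction over the rows. -/
theorem mul_L1inv_succ (u : ℕ → ℝ) (A : Matrix ℕ ℕ ℝ) (n j : ℕ) :
    mul (L1inv u) A (n + 1) j = A (n + 1) j - u (n + 1) * mul (L1inv u) A n j := by
  rw [mul_L1inv_apply u A (Nat.lt_succ_self (n + 1)),
    mul_L1inv_apply u A (show n < n + 1 + 1 by omega), Finset.mul_sum]
  simp only [L1inv_succ_apply, sub_mul, Finset.sum_sub_distrib, ite_mul, one_mul, zero_mul,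
    Finset.sum_ite_eq', Finset.mem_range, Nat.lt_succ_self, if_true, mul_assoc]

/-- `w_n = u_n (b_{n+1} - b_{n-1})`. -/
def laxW (u b : ℕ → ℝ) (n : ℕ) : ℝ := u n * (b (n + 1) - prev b n)

/-- The tridiagonal part of the Lax matrix. -/
def laxH (u b : ℕ → ℝ) (n j : ℕ) : ℝ :=
  if j = n + 1 then 1 else if j = n then b (n + 1) - b n else
    if j + 1 = n then -(u n * u (n + 1)) else 0

variable (u b : ℕ → ℝ)

theorem laxB_zero (j : ℕ) : laxB u b 0 j = 0 := by
  rw [laxB, mul_L1inv_zero]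
  simp [B2]

theorem laxB_apply (n j : ℕ) : laxB u b n j =
    if j < n then laxW u b (j + 1) * ∏ k ∈ Finset.Ioc (j + 1) n, (-u k) else 0 := by
  induction n with
  | zero => rw [laxB_zero]; simp
  | succ n ih =>
    rw [laxB, mul_L1inv_succ, ← laxB, ih]
    simp only [B2, Matrix.of_apply, add_left_inj]
    rcases lt_trichotomy j n with h | h | h
    · rw [if_neg h.ne, if_pos h, if_pos (by omega), Finset.prod_Ioc_succ_top (by omega)]
      ring
    · subst h
      simp [laxW, prev]
    · rw [if_neg h.ne', if_neg (by omega), if_neg (by omega)]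
      ring

/-- Equivalent to L_2 = L_1 H - B_2 with H tridiagonal. Hence [B, L] = [B, H], and each entry of the
commutator involves only finitely many neighbouring entries of B. -/
theorem laxL_eq (h0 : u 0 = 0) (n j : ℕ) : laxL u b n j = laxH u b n j - laxB u b n j := by
  induction n with
  | zero =>
    rw [laxL, mul_L1inv_zero, laxB_zero]
    simp [L2, laxH, h0]
  | succ n ih =>
    rw [laxL, mul_L1inv_succ, ← laxL, ih, laxB, mul_L1inv_succ, ← laxB]
    have : laxH u b (n + 1) j - B2 u b (n + 1) j = L2 u b (n + 1) j - u (n + 1) * laxH u b n j := by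
      simp only [laxH, B2, L2, Matrix.of_apply]
      split_ifs <;> first | omega | (subst_vars; ring)
    linear_combination -this

theorem laxH_eq_row (n k : ℕ) : laxH u b n k = (if k = n + 1 then 1 else 0) +
    (if k = n then b (n + 1) - b n else 0) + if k + 1 = n then -(u n * u (n + 1)) else 0 := by
  unfold laxH
  split_ifs <;> first | omega | ring

theorem laxH_eq_column (k j : ℕ) : laxH u b k j = (if k + 1 = j then 1 else 0) +
    (if k = j then b (j + 1) - b j else 0) +
    if k = j + 1 then -(u (j + 1) * u (j + 2)) else 0 := by
  unfold laxH
  split_ifs <;> first | omega | (subst_vars; ring)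

theorem sum_ite_succ_eq (f : ℕ → ℝ) {j N : ℕ} (hj : j ≤ N) :
    ∑ k ∈ Finset.range N, (if k + 1 = j then f k else 0) = prev f j := by
  cases j with
  | zero => simp [prev]
  | succ j => simp [prev, show j < N by omega]

theorem commutator_eq (h0 : u 0 = 0) (n j : ℕ) :
    mul (laxB u b) (laxL u b) n j - mul (laxL u b) (laxB u b) n j =
      prev (laxB u b n) j + laxB u b n j * (b (j + 1) - b j) -
        laxB u b n (j + 1) * (u (j + 1) * u (j + 2)) -
      (laxB u b (n + 1) j + (b (n + 1) - b n) * laxB u b n j -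
        u n * u (n + 1) * prev (fun m => laxB u b m j) n) := by
  set N := n + j + 2 with hN
  have h1 : mul (laxB u b) (laxL u b) n j = ∑ k ∈ Finset.range N, laxB u b n k * laxL u b k j := by
    simp only [mul, Matrix.of_apply]
    refine finsum_eq_sum_of_support_subset _ fun k hk => ?_
    rw [Finset.coe_range, Set.mem_Iio]
    by_contra hk'
    exact hk (by simp only [laxB_apply, if_neg (show ¬ k < n by omega), zero_mul])
  have h2 : mul (laxL u b) (laxB u b) n j = ∑ k ∈ Finset.range N, laxL u b n k * laxB u b k j := by
    simp only [mul, Matrix.of_apply]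
    refine finsum_eq_sum_of_support_subset _ fun k hk => ?_
    rw [Finset.coe_range, Set.mem_Iio]
    by_contra hk'
    refine hk ?_
    change laxL u b n k * laxB u b k j = 0
    rw [laxL_eq u b h0, laxB_apply u b n k, if_neg (by omega), laxH, if_neg (by omega),
      if_neg (by omega), if_neg (by omega)]
    ring
  have h3 : ∑ k ∈ Finset.range N, laxB u b n k * laxH u b k j =
      prev (laxB u b n) j + laxB u b n j * (b (j + 1) - b j) -
        laxB u b n (j + 1) * (u (j + 1) * u (j + 2)) := by
    simp only [laxH_eq_column, mul_add, Finset.sum_add_distrib, mul_ite, mul_one, mul_zero,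
      Finset.sum_ite_eq', Finset.mem_range]
    rw [sum_ite_succ_eq _ (by omega), if_pos (by omega), if_pos (by omega)]
    ring
  have h4 : ∑ k ∈ Finset.range N, laxH u b n k * laxB u b k j =
      laxB u b (n + 1) j + (b (n + 1) - b n) * laxB u b n j -
        u n * u (n + 1) * prev (fun m => laxB u b m j) n := by
    simp only [laxH_eq_row, add_mul, Finset.sum_add_distrib, ite_mul, one_mul, zero_mul,
      Finset.sum_ite_eq', Finset.mem_range]
    rw [sum_ite_succ_eq _ (by omega), if_pos (by omega), if_pos (by omega)]
    cases n with
    | zero => simp [prev]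
    | succ n => simp only [prev]; ring
  rw [← h3, ← h4, h1, h2, ← Finset.sum_sub_distrib, ← Finset.sum_sub_distrib]
  refine Finset.sum_congr rfl fun k _ => ?_
  rw [laxL_eq u b h0, laxL_eq u b h0]
  ring

theorem prod_Ioc_eq_mul (f : ℕ → ℝ) {j n : ℕ} (h : j < n) :
    ∏ k ∈ Finset.Ioc j n, f k = f (j + 1) * ∏ k ∈ Finset.Ioc (j + 1) n, f k := by
  rw [← Finset.prod_Ioc_consecutive f (Nat.le_succ j) h]
  simp

theorem prev_laxB (h0 : u 0 = 0) {n j : ℕ} (h : j < n) : prev (laxB u b n) j =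
    laxW u b j * (-u (j + 1) * ∏ k ∈ Finset.Ioc (j + 1) n, (-u k)) := by
  cases j with
  | zero => simp [prev, laxW, h0]
  | succ j => rw [prev, laxB_apply, if_pos (by omega), prod_Ioc_eq_mul _ (by omega)]

theorem commutator_of_lt (h0 : u 0 = 0) {n j : ℕ} (h : n < j) :
    mul (laxB u b) (laxL u b) n j - mul (laxL u b) (laxB u b) n j = 0 := by
  have h1 : prev (laxB u b n) j = 0 := by
    cases j with
    | zero => rfl
    | succ j => rw [prev, laxB_apply, if_neg (by omega)]
  have h2 : prev (fun m => laxB u b m j) n = 0 := by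
    cases n with
    | zero => rfl
    | succ n => rw [prev, laxB_apply, if_neg (by omega)]
  rw [commutator_eq u b h0, h1, h2, laxB_apply, if_neg (by omega), laxB_apply, if_neg (by omega),
    laxB_apply, if_neg (by omega)]
  ring

theorem commutator_diag (h0 : u 0 = 0) (n : ℕ) :
    mul (laxB u b) (laxL u b) n n - mul (laxL u b) (laxB u b) n n =
      laxW u b n - laxW u b (n + 1) := by
  have h1 : prev (laxB u b n) n = laxW u b n := by
    cases n with
    | zero => simp [prev, laxW, h0]
    | succ n => rw [prev, laxB_apply, if_pos (by omega)]; simp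
  have h2 : prev (fun m => laxB u b m n) n = 0 := by
    cases n with
    | zero => rfl
    | succ n => rw [prev, laxB_apply, if_neg (by omega)]
  rw [commutator_eq u b h0, h1, h2, laxB_apply, if_neg (by omega), laxB_apply, if_neg (by omega),
    laxB_apply, if_pos (by omega)]
  simp

theorem commutator_subdiag (h0 : u 0 = 0) (n : ℕ) :
    mul (laxB u b) (laxL u b) (n + 1) n - mul (laxL u b) (laxB u b) (n + 1) n =
      -(u (n + 1) * laxW u b n) +
        (b (n + 1) - b n - (b (n + 2) - b (n + 1)) + u (n + 2)) * laxW u b (n + 1) := by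
  have h2 : prev (fun m => laxB u b m n) (n + 1) = 0 := by
    rw [prev, laxB_apply, if_neg (by omega)]
  rw [commutator_eq u b h0, prev_laxB u b h0 (Nat.lt_succ_self n), h2, laxB_apply u b (n + 1) n,
    if_pos (by omega), laxB_apply u b (n + 1) (n + 1), if_neg (by omega),
    laxB_apply u b (n + 1 + 1) n, if_pos (by omega),
    Finset.prod_Ioc_succ_top (show n + 1 ≤ n + 1 by omega), Finset.Ioc_self, Finset.prod_empty]
  ring

/-- All entries of B involved share the product over j + 2, …, n up to single factors -u_k;
factoring it out leaves a local expression. -/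
theorem commutator_lower (h0 : u 0 = 0) {n j : ℕ} (h : j + 1 < n) :
    mul (laxB u b) (laxL u b) n j - mul (laxL u b) (laxB u b) n j =
      (∏ k ∈ Finset.Ioc (j + 1) n, (-u k)) * (-(laxW u b j * u (j + 1)) +
        (b (j + 1) - b j - (b (n + 1) - b n)) * laxW u b (j + 1) +
        u (j + 1) * laxW u b (j + 2)) := by
  obtain ⟨m, rfl⟩ : ∃ m, n = m + 1 := ⟨n - 1, by omega⟩
  have e1 := prod_Ioc_eq_mul (fun k => -u k) h
  have e2 := Finset.prod_Ioc_succ_top (show j + 1 ≤ m by omega) (fun k => -u k)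
  have e3 := Finset.prod_Ioc_succ_top (show j + 1 ≤ m + 1 by omega) (fun k => -u k)
  rw [commutator_eq u b h0, prev_laxB u b h0 (by omega), prev, laxB_apply u b (m + 1) j,
    if_pos (by omega), laxB_apply u b (m + 1) (j + 1), if_pos h, laxB_apply u b (m + 1 + 1) j,
    if_pos (by omega), laxB_apply u b m j, if_pos (by omega)]
  linear_combination (-laxW u b (j + 2) * u (j + 1)) * e1 - laxW u b (j + 1) * e3 +
    (laxW u b (j + 1) * u (m + 2)) * e2

end Matrices

end BToda

namespace BToda

/-! ### The Lax equation and the lattice -/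

section Compatibility

theorem hasDerivAt_prod_neg {u : ℕ → ℝ → ℝ} {r : ℕ → ℝ} {t : ℝ}
    (hu : ∀ k, HasDerivAt (u (k + 1)) (u (k + 1) t * r (k + 1)) t) (i n : ℕ) :
    HasDerivAt (fun s => ∏ k ∈ Finset.Ioc i n, (-u k s))
      ((∏ k ∈ Finset.Ioc i n, (-u k t)) * ∑ k ∈ Finset.Ioc i n, r k) t := by
  induction n with
  | zero => simpa using hasDerivAt_const t (1 : ℝ)
  | succ n ih =>
    by_cases h : i ≤ n
    · simp only [Finset.prod_Ioc_succ_top h, Finset.sum_Ioc_succ_top h]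
      refine (ih.mul (hu n).neg).congr_deriv ?_
      simp only [Pi.neg_apply]
      ring
    · rw [Finset.Ioc_eq_empty (by omega)]
      simpa using hasDerivAt_const t (1 : ℝ)

variable {u b : ℕ → ℝ → ℝ} {t : ℝ}

theorem hasDerivAt_laxW {r : ℕ → ℝ}
    (hu : ∀ k, HasDerivAt (u (k + 1)) (u (k + 1) t * r (k + 1)) t)
    (hb : ∀ n, HasDerivAt (b n) (-laxW (fun k => u k t) (fun k => b k t) n) t) (n : ℕ) :
    HasDerivAt (fun s => laxW (fun k => u k s) (fun k => b k s) (n + 1))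
      (laxW (fun k => u k t) (fun k => b k t) (n + 1) * r (n + 1) +
        u (n + 1) t * (laxW (fun k => u k t) (fun k => b k t) n -
          laxW (fun k => u k t) (fun k => b k t) (n + 2))) t := by
  refine ((hu n).mul ((hb (n + 2)).sub (hb n))).congr_deriv ?_
  simp only [laxW, prev, Pi.sub_apply]
  ring

theorem hasDerivAt_laxL_subdiag {r : ℕ → ℝ} (h0 : ∀ s, u 0 s = 0)
    (hu : ∀ k, HasDerivAt (u (k + 1)) (u (k + 1) t * r (k + 1)) t)
    (hb : ∀ n, HasDerivAt (b n) (-laxW (fun k => u k t) (fun k => b k t) n) t) (n : ℕ) :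
    HasDerivAt (fun s => laxL (fun k => u k s) (fun k => b k s) (n + 1) n)
      (-(u (n + 1) t * u (n + 2) t * (r (n + 1) + r (n + 2))) -
        (laxW (fun k => u k t) (fun k => b k t) (n + 1) * r (n + 1) +
        u (n + 1) t * (laxW (fun k => u k t) (fun k => b k t) n -
          laxW (fun k => u k t) (fun k => b k t) (n + 2)))) t := by
  have e : (fun s => laxL (fun k => u k s) (fun k => b k s) (n + 1) n) = fun s =>
      -(u (n + 1) s * u (n + 2) s) - laxW (fun k => u k s) (fun k => b k s) (n + 1) := by
    ext s
    rw [laxL_eq _ _ (h0 s), laxB_apply, if_pos (Nat.lt_succ_self n), laxH, if_neg (by omega),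
      if_neg (by omega), if_pos rfl, Finset.Ioc_self, Finset.prod_empty, mul_one]
  rw [e]
  refine ((((hu n).mul (hu (n + 1))).neg).sub (hasDerivAt_laxW hu hb n)).congr_deriv ?_
  ring

theorem hasDerivAt_laxL_lower {r : ℕ → ℝ} (h0 : ∀ s, u 0 s = 0)
    (hu : ∀ k, HasDerivAt (u (k + 1)) (u (k + 1) t * r (k + 1)) t)
    (hb : ∀ n, HasDerivAt (b n) (-laxW (fun k => u k t) (fun k => b k t) n) t) {n j : ℕ}
    (h : j + 1 < n) :
    HasDerivAt (fun s => laxL (fun k => u k s) (fun k => b k s) n j)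
      (-((∏ k ∈ Finset.Ioc (j + 1) n, (-u k t)) *
        (laxW (fun k => u k t) (fun k => b k t) (j + 1) * ∑ k ∈ Finset.Ioc j n, r k +
        u (j + 1) t * (laxW (fun k => u k t) (fun k => b k t) j -
          laxW (fun k => u k t) (fun k => b k t) (j + 2))))) t := by
  have e : (fun s => laxL (fun k => u k s) (fun k => b k s) n j) = fun s =>
      -(laxW (fun k => u k s) (fun k => b k s) (j + 1) *
        ∏ k ∈ Finset.Ioc (j + 1) n, (-u k s)) := by
    ext s
    rw [laxL_eq _ _ (h0 s), laxB_apply, if_pos (by omega), laxH, if_neg (by omega),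
      if_neg (by omega), if_neg (by omega), zero_sub]
  rw [e]
  refine ((hasDerivAt_laxW hu hb j).mul (hasDerivAt_prod_neg hu (j + 1) n)).neg.congr_deriv ?_
  have : ∑ k ∈ Finset.Ioc j n, r k = r (j + 1) + ∑ k ∈ Finset.Ioc (j + 1) n, r k := by
    rw [← Finset.sum_Ioc_consecutive r (Nat.le_succ j) (by omega : j + 1 ≤ n)]
    simp
  rw [this]
  ring

theorem sum_Ioc_sub (c : ℕ → ℝ) {j n : ℕ} (h : j < n) :
    ∑ k ∈ Finset.Ioc j n, (c k - prev c k) = c n - c j := by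
  induction n, h using Nat.le_induction with
  | base => simp [prev]
  | succ n hn ih => rw [Finset.sum_Ioc_succ_top (by omega), ih, prev]; ring

theorem laxEqAt_of_latticeAt (hu0 : ∀ s, u 0 s = 0) (hb0 : ∀ s, b 0 s = 0)
    (h : LatticeAt u b t) : LaxEqAt u b t := by
  set c : ℕ → ℝ := fun k => b (k + 1) t - b k t with hc
  -- The logarithmic derivative of u_k prescribed by the lattice. It is a difference, so its sums in
  -- the derivatives of the lower entries telescope.
  set r : ℕ → ℝ := fun k => c k - prev c k with hr
  have hu : ∀ k, HasDerivAt (u (k + 1)) (u (k + 1) t * r (k + 1)) t := fun k =>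
    (h k).1.congr_deriv (by simp only [hr, hc, prev]; ring)
  have hb : ∀ n, HasDerivAt (b n) (-laxW (fun k => u k t) (fun k => b k t) n) t := by
    intro n
    cases n with
    | zero =>
      rw [show b 0 = fun _ => 0 from funext hb0]
      simpa [laxW, hu0 t] using hasDerivAt_const t (0 : ℝ)
    | succ n => exact (h n).2.congr_deriv (by simp only [laxW, prev]; ring)
  have hu0' : (fun k => u k t) 0 = 0 := hu0 t
  intro n j
  rcases (by omega : n < j ∨ n = j ∨ n = j + 1 ∨ j + 1 < n) with hj | rfl | rfl | hj
  · rw [commutator_of_lt _ _ hu0' hj]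
    have e : (fun s => laxL (fun k => u k s) (fun k => b k s) n j) =
        fun _ => if j = n + 1 then 1 else 0 := by
      ext s
      rw [laxL_eq _ _ (hu0 s), laxB_apply, if_neg (by omega), laxH, if_neg (by omega : j ≠ n),
        if_neg (by omega : ¬ j + 1 = n), sub_zero]
    rw [e]
    exact hasDerivAt_const _ _
  · rw [commutator_diag _ _ hu0']
    have e : (fun s => laxL (fun k => u k s) (fun k => b k s) n n) =
        fun s => b (n + 1) s - b n s := by
      ext s
      rw [laxL_eq _ _ (hu0 s), laxB_apply]
      simp [laxH]
    rw [e]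
    exact ((hb (n + 1)).sub (hb n)).congr_deriv (by ring)
  · rw [commutator_subdiag _ _ hu0']
    refine (hasDerivAt_laxL_subdiag hu0 hu hb j).congr_deriv ?_
    simp only [laxW, prev, hr, hc]
    ring
  · rw [commutator_lower _ _ hu0' hj]
    refine (hasDerivAt_laxL_lower hu0 hu hb hj).congr_deriv ?_
    rw [hr, sum_Ioc_sub c (by omega)]
    simp only [hc]
    ring

theorem latticeAt_of_laxEqAt (hu0 : ∀ s, u 0 s = 0) (hb0 : ∀ s, b 0 s = 0)
    (hud : ∀ n, DifferentiableAt ℝ (u n) t)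
    (hne : ∀ n, u (n + 1) t ≠ 0) (hm : ∃ m, b (m + 2) t ≠ b m t) (h : LaxEqAt u b t) :
    LatticeAt u b t := by
  set W : ℕ → ℝ := laxW (fun k => u k t) (fun k => b k t) with hW
  have hu0' : (fun k => u k t) 0 = 0 := hu0 t
  -- The diagonal entries of L are b_{n+1} - b_n, so their equations telescope from b_0 = 0.
  have hb : ∀ n, HasDerivAt (b n) (-W n) t := by
    intro n
    induction n with
    | zero =>
      rw [show b 0 = fun _ => 0 from funext hb0]
      simpa [hW, laxW, hu0 t] using hasDerivAt_const t (0 : ℝ)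
    | succ n ih =>
      have h1 := h n n
      rw [commutator_diag _ _ hu0', ← hW] at h1
      have e : (fun s => laxL (fun k => u k s) (fun k => b k s) n n) =
          fun s => b (n + 1) s - b n s := by
        ext s
        rw [laxL_eq _ _ (hu0 s), laxB_apply]
        simp [laxH]
      rw [e] at h1
      refine ((h1.add ih).congr_deriv (by ring)).congr_of_eventuallyEq
        (Filter.Eventually.of_forall fun s => ?_)
      simp
  set c : ℕ → ℝ := fun k => b (k + 1) t - b k t with hc
  set r : ℕ → ℝ := fun k => deriv (u k) t / u k t with hr
  have hu : ∀ k, HasDerivAt (u (k + 1)) (u (k + 1) t * r (k + 1)) t := fun k =>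
    (hud (k + 1)).hasDerivAt.congr_deriv (by rw [hr]; field_simp [hne k])
  -- The defect in the equation for u_k. The subdiagonal gives `hS` and the lower entries give `hO`.
  -- If every W_n vanished, only g_{n+1} + g_{n+2} = 0 would remain, hence the need for `m`.
  set g : ℕ → ℝ := fun k => r k - (c k - prev c k) with hg
  have hS : ∀ n, u (n + 1) t * u (n + 2) t * (g (n + 1) + g (n + 2)) +
      W (n + 1) * g (n + 1) = 0 := by
    intro n
    have h1 := (hasDerivAt_laxL_subdiag hu0 hu hb n).unique
      ((h (n + 1) n).congr_deriv (commutator_subdiag _ _ hu0' n))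
    simp only [laxW, prev] at h1
    simp only [hg, hc, hW, laxW, prev]
    linear_combination -h1
  have hO : ∀ j n, j + 1 < n → W (j + 1) * ∑ k ∈ Finset.Ioc j n, g k = 0 := by
    intro j n hj
    have h1 := (hasDerivAt_laxL_lower hu0 hu hb hj).unique
      ((h n j).congr_deriv (commutator_lower _ _ hu0' hj))
    rw [hg, Finset.sum_sub_distrib, sum_Ioc_sub c (by omega)]
    have hP : ∏ k ∈ Finset.Ioc (j + 1) n, (-u k t) ≠ 0 := by
      refine Finset.prod_ne_zero_iff.2 fun k hk => neg_ne_zero.2 ?_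
      obtain ⟨l, rfl⟩ : ∃ l, k = l + 1 := ⟨k - 1, by have := (Finset.mem_Ioc.1 hk).1; omega⟩
      exact hne l
    refine mul_left_cancel₀ hP ?_
    simp only [← hW] at h1
    simp only [hc]
    linear_combination -h1
  obtain ⟨m, hm⟩ := hm
  have hWm : W (m + 1) ≠ 0 := mul_ne_zero (hne m) (sub_ne_zero.2 hm)
  have huu : ∀ n, u (n + 1) t * u (n + 2) t ≠ 0 := fun n => mul_ne_zero (hne n) (hne (n + 1))
  have hsum : ∀ n, m + 1 < n → ∑ k ∈ Finset.Ioc m n, g k = 0 := fun n hn =>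
    (mul_eq_zero.1 (hO m n hn)).resolve_left hWm
  have hpair : g (m + 1) + g (m + 2) = 0 := by
    have := hsum (m + 2) (by omega)
    rwa [Finset.sum_Ioc_succ_top (by omega), Finset.sum_Ioc_succ_top (by omega), Finset.Ioc_self,
      Finset.sum_empty, zero_add] at this
  have hgm : g (m + 1) = 0 := by
    have := hS m
    rw [hpair, mul_zero, zero_add] at this
    exact (mul_eq_zero.1 this).resolve_left hWm
  -- Upwards from m + 1: the partial sums of g vanish, so do their differences.
  have hge : ∀ n, g (m + 1 + n) = 0 := by
    intro n
    match n with
    | 0 => exact hgm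
    | 1 => rw [hgm, zero_add] at hpair; exact hpair
    | n + 2 =>
      have h1 := hsum (m + 1 + (n + 2)) (by omega)
      rw [show m + 1 + (n + 2) = m + 2 + n + 1 by omega] at h1 ⊢
      rwa [Finset.sum_Ioc_succ_top (by omega), hsum (m + 2 + n) (by omega), zero_add] at h1
  -- Downwards: if W_{n+1} = 0 the subdiagonal relation suffices, otherwise the entry (n+2, n) gives
  -- g_{n+1} + g_{n+2} = 0.
  have hstep : ∀ n, g (n + 2) = 0 → g (n + 1) = 0 := by
    intro n hn
    by_cases hWn : W (n + 1) = 0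
    · have := hS n
      rw [hn, hWn, zero_mul, add_zero, add_zero] at this
      exact (mul_eq_zero.1 this).resolve_left (huu n)
    · have h1 := (mul_eq_zero.1 (hO n (n + 2) (by omega))).resolve_left hWn
      rwa [Finset.sum_Ioc_succ_top (by omega), Finset.sum_Ioc_succ_top (by omega),
        Finset.Ioc_self, Finset.sum_empty, zero_add, hn, add_zero] at h1
  have hall : ∀ n, g (n + 1) = 0 := by
    intro n
    rcases le_total m n with hmn | hmn
    · obtain ⟨k, rfl⟩ := Nat.exists_eq_add_of_le hmn
      have := hge k
      rwa [show m + 1 + k = m + k + 1 by omega] at this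
    · induction hmn using Nat.decreasingInduction with
      | self => exact hgm
      | of_succ k _ ih => exact hstep k ih
  intro n
  constructor
  · refine (hu n).congr_deriv ?_
    have := hall n
    simp only [hg, hc, prev] at this
    linear_combination (u (n + 1) t) * this
  · refine (hb (n + 1)).congr_deriv ?_
    simp only [hW, laxW, prev]
    ring

end Compatibility

/-! ### The linear problems for the column of polynomials -/

section LinearProblems

theorem mulVec_eq_sum {M : Matrix ℕ ℕ ℝ} {n K : ℕ} (hM : ∀ k, K ≤ k → M n k = 0)
    (Φ : ℕ → ℝ[X]) : mulVec M Φ n = ∑ k ∈ Finset.range K, C (M n k) * Φ k := by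
  refine finsum_eq_sum_of_support_subset _ fun k hk => ?_
  rw [Finset.coe_range, Set.mem_Iio]
  by_contra hk'
  exact hk (by simp only [hM k (not_lt.1 hk'), C_0, zero_mul])

theorem mulVec_mul_L1inv_zero (u : ℕ → ℝ) (A : Matrix ℕ ℕ ℝ) (Φ : ℕ → ℝ[X]) :
    mulVec (mul (L1inv u) A) Φ 0 = mulVec A Φ 0 := by
  simp only [mulVec, mul_L1inv_zero]

theorem mulVec_mul_L1inv_succ (u : ℕ → ℝ) {A : Matrix ℕ ℕ ℝ}
    (hA : ∀ n k, n + 2 ≤ k → A n k = 0) (Φ : ℕ → ℝ[X]) (n : ℕ) :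
    mulVec (mul (L1inv u) A) Φ (n + 1) =
      mulVec A Φ (n + 1) - C (u (n + 1)) * mulVec (mul (L1inv u) A) Φ n := by
  have h : ∀ n k, n + 2 ≤ k → mul (L1inv u) A n k = 0 := by
    intro n k hk
    rw [mul_L1inv_apply u A (Nat.lt_succ_self n)]
    refine Finset.sum_eq_zero fun l hl => ?_
    have := Finset.mem_range.1 hl
    rw [hA l k (by omega), mul_zero]
  rw [mulVec_eq_sum (h (n + 1)), mulVec_eq_sum (K := n + 1 + 2) fun k hk => h n k (by omega),
    mulVec_eq_sum (hA (n + 1)), Finset.mul_sum, ← Finset.sum_sub_distrib]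
  refine Finset.sum_congr rfl fun k _ => ?_
  rw [mul_L1inv_succ, C_sub, C_mul]
  ring

theorem L2_apply_eq_zero (u b : ℕ → ℝ) (n k : ℕ) (h : n + 2 ≤ k) : L2 u b n k = 0 := by
  simp only [L2, Matrix.of_apply]
  rw [if_neg (by omega), if_neg (by omega), if_neg (by omega), if_neg (by omega)]

theorem B2_apply_eq_zero (u b : ℕ → ℝ) (n k : ℕ) (h : n + 2 ≤ k) : B2 u b n k = 0 := by
  simp only [B2, Matrix.of_apply]
  rw [if_neg (by omega)]

theorem mulVec_L2 (u b : ℕ → ℝ) (Φ : ℕ → ℝ[X]) (n : ℕ) :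
    mulVec (L2 u b) Φ n = Φ (n + 1) + C (b (n + 1) - b n + u n) * Φ n -
      C (u n * (b (n + 1) - b n + u (n + 1))) * prev Φ n -
      C (u n ^ 2 * prev u n) * prev (prev Φ) n := by
  rw [mulVec_eq_sum (L2_apply_eq_zero u b n)]
  match n with
  | 0 =>
    simp [Finset.sum_range_succ, L2, prev]
    ring
  | 1 =>
    simp [Finset.sum_range_succ, L2, prev]
    ring
  | n + 2 =>
    rw [Finset.sum_range_succ, Finset.sum_range_succ, Finset.sum_range_succ,
      Finset.sum_range_succ, Finset.sum_eq_zero fun k hk => by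
        have := Finset.mem_range.1 hk
        simp only [L2, Matrix.of_apply]
        rw [if_neg (by omega), if_neg (by omega), if_neg (by omega), if_neg (by omega), C_0,
          zero_mul]]
    simp [L2, prev, show n ≠ n + 2 + 1 by omega]
    ring

theorem mulVec_B2_zero (u b : ℕ → ℝ) (Φ : ℕ → ℝ[X]) : mulVec (B2 u b) Φ 0 = 0 := by
  simp [mulVec, B2]

theorem mulVec_B2_succ (u b : ℕ → ℝ) (Φ : ℕ → ℝ[X]) (n : ℕ) :
    mulVec (B2 u b) Φ (n + 1) = C (u (n + 1) * (b (n + 2) - b n)) * Φ n := by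
  rw [mulVec, finsum_eq_single _ n fun k hk => by simp [B2, hk]]
  simp [B2]

variable {ρ : ℝ → ℝ} {I : Set ℝ} {t : ℝ}
variable (hI : IsOpen I) (hρ : ∀ x, 0 < x → 0 ≤ ρ x) (hne : ¬ (∀ᵐ x ∂posVol, ρ x = 0))
  (hw : ∀ t ∈ I, ∀ i, Integrable (wt ρ t i) posVol) (ht : t ∈ I)

include hI hρ hne hw ht

/-- The recurrence says z L_1 Φ = L_2 Φ; L_1 is inverted row by row. -/
theorem X_mul_psop (n : ℕ) : X * psop ρ n t =
    mulVec (laxL (fun k => u ρ k t) (fun k => b ρ k t)) (fun k => psop ρ k t) n := by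
  have hrec := fun n => (psop_recurrence hI hρ hne hw ht n).trans
    (mulVec_L2 (fun k => u ρ k t) (fun k => b ρ k t) (fun k => psop ρ k t) n).symm
  induction n with
  | zero =>
    rw [laxL, mulVec_mul_L1inv_zero, ← hrec]
    simp [prev]
  | succ n ih =>
    rw [laxL, mulVec_mul_L1inv_succ _ (L2_apply_eq_zero _ _), ← laxL, ← ih, ← hrec]
    simp only [prev]
    ring

theorem polyDeriv_psop_eq (n : ℕ) : polyDeriv (psop ρ n) n t =
    mulVec (laxB (fun k => u ρ k t) (fun k => b ρ k t)) (fun k => psop ρ k t) n := by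
  induction n with
  | zero =>
    rw [laxB, mulVec_mul_L1inv_zero, mulVec_B2_zero]
    exact (orthData hI hρ hne hw ht).deriv_zero
  | succ n ih =>
    rw [laxB, mulVec_mul_L1inv_succ _ (B2_apply_eq_zero _ _), ← laxB, ← ih, mulVec_B2_succ,
      ← psop_deriv hI hρ hne hw ht]
    ring

end LinearProblems

end BToda

/-! ### The main theorem -/

theorem mainTheorem2 :
    -- the polynomials
    (∀ (ρ : ℝ → ℝ) (I : Set ℝ), IsOpen I →
      (∀ x : ℝ, 0 < x → 0 ≤ ρ x) →
      ¬ (∀ᵐ x ∂(volume.restrict (Ioi (0 : ℝ))), ρ x = 0) →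
      (∀ t ∈ I, ∀ i : ℕ, IntegrableOn (fun x => x ^ i * Real.exp (t * x) * ρ x) (Ioi 0)) →
      ∀ t ∈ I,
        -- the polynomials, `u_n` and `b_n` are well defined, and `u_0 = b_0 = 0`
        (∀ n, BToda.tau ρ n t ≠ 0 ∧ DifferentiableAt ℝ (BToda.tau ρ n) t) ∧
        BToda.u ρ 0 t = 0 ∧ BToda.b ρ 0 t = 0 ∧
        -- the four-term recurrence, where `P_{-1} = P_{-2} = 0` and `u_{-1} = 0`
        (∀ n, X * (BToda.psop ρ n t +
              C (BToda.u ρ n t) * BToda.prev (fun k => BToda.psop ρ k t) n) =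
            BToda.psop ρ (n + 1) t +
            C (BToda.b ρ (n + 1) t - BToda.b ρ n t + BToda.u ρ n t) * BToda.psop ρ n t -
            C (BToda.u ρ n t * (BToda.b ρ (n + 1) t - BToda.b ρ n t + BToda.u ρ (n + 1) t)) *
              BToda.prev (fun k => BToda.psop ρ k t) n -
            C (BToda.u ρ n t ^ 2 * BToda.prev (fun k => BToda.u ρ k t) n) *
              BToda.prev (BToda.prev (fun k => BToda.psop ρ k t)) n) ∧
        -- the evolution in `t`
        (∀ n z, DifferentiableAt ℝ (fun s => (BToda.psop ρ n s).eval z) t) ∧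
        (∀ n z, deriv (fun s => (BToda.psop ρ (n + 1) s).eval z) t +
              BToda.u ρ (n + 1) t * deriv (fun s => (BToda.psop ρ n s).eval z) t =
            BToda.u ρ (n + 1) t * (BToda.b ρ (n + 2) t - BToda.b ρ n t) *
              (BToda.psop ρ n t).eval z) ∧
        -- the linear problems `z Φ = L Φ` and `Φ_t = B Φ`
        (∀ n, X * BToda.psop ρ n t =
          BToda.mulVec (BToda.laxL (fun k => BToda.u ρ k t) (fun k => BToda.b ρ k t))
            (fun k => BToda.psop ρ k t) n) ∧
        (∀ n z, HasDerivAt (fun s => (BToda.psop ρ n s).eval z)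
          ((BToda.mulVec (BToda.laxB (fun k => BToda.u ρ k t) (fun k => BToda.b ρ k t))
            (fun k => BToda.psop ρ k t) n).eval z) t) ∧
        -- the Lax equation and the lattice
        BToda.LaxEqAt (BToda.u ρ) (BToda.b ρ) t ∧
        BToda.LatticeAt (BToda.u ρ) (BToda.b ρ) t) ∧
    -- the compatibility condition `dL/dt = [B, L]` is the 1+1 B-Toda lattice
    (∀ (u b : ℕ → ℝ → ℝ) (t : ℝ), (∀ s, u 0 s = 0) → (∀ s, b 0 s = 0) →
      (∀ n, DifferentiableAt ℝ (u n) t) → (∀ n, DifferentiableAt ℝ (b n) t) →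
      (BToda.LatticeAt u b t → BToda.LaxEqAt u b t) ∧
      ((∀ n, u (n + 1) t ≠ 0) → (∃ m, b (m + 2) t ≠ b m t) →
        BToda.LaxEqAt u b t → BToda.LatticeAt u b t)) := by
  refine ⟨?_, fun u b t hu0 hb0 hu _ => ⟨BToda.laxEqAt_of_latticeAt hu0 hb0,
    BToda.latticeAt_of_laxEqAt hu0 hb0 hu⟩⟩
  intro ρ I hI hρ hne hw t ht
  have hd := fun n z => BToda.hasDerivAt_eval (fun s => BToda.natDegree_psop_le (ρ := ρ) (t := s) n)
    (BToda.differentiableAt_coeff_psop hI hρ hne hw ht n) z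
  have hlat := BToda.latticeAt_u_b hI hρ hne hw ht
  refine ⟨fun n => ⟨BToda.tau_ne_zero hρ hne hw ht n,
    BToda.differentiableAt_tau (BToda.differentiableAt_entry hI hρ hw ht) n⟩,
    BToda.u_zero ρ t, BToda.b_zero ρ t, BToda.psop_recurrence hI hρ hne hw ht,
    fun n z => (hd n z).differentiableAt, fun n z => ?_, BToda.X_mul_psop hI hρ hne hw ht,
    fun n z => ?_, BToda.laxEqAt_of_latticeAt (BToda.u_zero ρ) (BToda.b_zero ρ) hlat, hlat⟩
  · rw [(hd (n + 1) z).deriv, (hd n z).deriv]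
    have := congrArg (fun p => p.eval z) (BToda.psop_deriv hI hρ hne hw ht n)
    simpa using this
  · rw [← BToda.polyDeriv_psop_eq hI hρ hne hw ht]
    exact hd n z
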